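/- Let $\mathbb{T}=(\mathbb{R}\cup\{-\infty\},\max,+)$ be the tropical semifield, let $S\subseteq\mathbb{T}$ be a sub-semifield different from $\mathbb{B}=\{0_{\mathbb{T}},1_{\mathbb{T}}\}$, and let $\Gamma=\log(S^\times)\subseteq\mathbb{R}$ be the corresponding additive group. Let $M$ be a finitely generated free abelian group, $N_{\mathbb{R}}=\operatorname{Hom}(M,\mathbb{R})$, and let $S[M]$ be the monoid algebra. A congruence $P$ on a semiring $A$ is prime if it is proper and $A/P$ is totally ordered (for $a\le b\Leftrightarrow a+b=b$) and cancellative; $\kappa(P)$ is the total semiring of fractions of $A/P$, $a\mapsto|a|_P$ is the canonical map $A\to\kappa(P)$, and $\operatorname{ht}(P)$ is the maximal length $k$ of a chain $P_0\subsetneq\cdots\subsetneq P_k=P$ of prime congruences. A totally ordered semifield carries the topology in which nonzero points are isolated and the sets $\{x<c\}$, $c\neq0$, are a neighbourhood basis of $0$; $S[M]$ carries the finest semiring topology for which $S\to S[M]$ is continuous. $\operatorname{Cont}_S S[M]$ is the set of prime congruences $P$ on $S[M]$ such that $S[M]/P$ is infinite and $S[M]\to\kappa(P)$ is continuous. A $\Gamma$-rational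 polyhedron is a set $\{x\in N_{\mathbb{R}}:\langle x,u_i\rangle\le\gamma_i,\ 1\le i\le q\}$ with $u_i\in M$, $\gamma_i\in\Gamma$, and a $\Gamma$-rational polyhedral set is a finite union of these; its dimension is the largest dimension of a convex set contained in it. For $f=\sum_u f_u\chi^u\in S[M]$ and $x\in N_{\mathbb{R}}$ let $f(x)=\max_u(\log f_u+\langle x,u\rangle)$. For $P\in\operatorname{Cont}_S S[M]$, let $\mathcal{F}_P$ be the set of $\Gamma$-rational polyhedral sets $U$ for which there are $f_0,\dots,f_n\in S[M]$ with $|f_i|_P\le|f_0|_P$ for $1\le i\le n$ and $\{x\in N_{\mathbb{R}}: f_0(x)\ge f_i(x),\ 1\le i\le n\}\subseteq U$. For a semifield extension $L/S$ with $L$ totally ordered, a subset $B\subseteq L$ is algebraically independent over $S$ if there is no nonzero polynomial over $S$ in variables indexed by $B$ such that the maximum of its terms evaluated at $B$ is attained at least twice or is $0$; $\operatorname{tr.deg}(L/S)$ is the maximal cardinality of an algebraically independent subset. Then for every $P\in\operatorname{Cont}_S S[M]$ the group $\kappa(P)^\times/S^\times$ has finite rank, $\operatorname{ht}(P)$ is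 finite, and $$\min\{\dim U: U\in\mathcal{F}_P\}=\operatorname{rk}(\kappa(P)^\times/S^\times)=\operatorname{rk}(M)-\operatorname{ht}(P)=\operatorname{tr.deg}(\kappa(P)/S).$$ Moreover, the minimum is the same if $U$ is restricted to the $\Gamma$-rational polyhedra in $\mathcal{F}_P$. -/

import Mathlib

open scoped Topology

noncomputable section

namespace TropCont

/-! ### Idempotent semirings and congruences -/

/-- The canonical order of an idempotent semiring: `a ≤ b` iff `a + b = b`. -/
def CanonLE {R : Type*} [Add R] (a b : R) : Prop := a + b = b

/-- The strict canonical order of an idempotent semiring. -/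
def CanonLT {R : Type*} [Add R] (a b : R) : Prop := CanonLE a b ∧ a ≠ b

/-- A prime congruence: a proper congruence whose quotient is totally ordered by the canonical
order (so in particular idempotent) and cancellative. -/
structure IsPrimeCon {A : Type*} [CommSemiring A] (P : RingCon A) : Prop where
  ne_top : P ≠ ⊤
  total : ∀ a b : P.Quotient, CanonLE a b ∨ CanonLE b a
  cancel : ∀ a b c : P.Quotient, a ≠ 0 → a * b = a * c → b = c

/-- The prime congruences of `A`, ordered by inclusion. -/
abbrev PrimeCon (A : Type*) [CommSemiring A] : Type _ := {P : RingCon A // IsPrimeCon P}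

/-- The height of a prime congruence: the supremum of the lengths of the chains
`P₀ ⊊ P₁ ⊊ ⋯ ⊊ Pₖ = P` of prime congruences. -/
def PrimeCon.ht {A : Type*} [CommSemiring A] (P : PrimeCon A) : ℕ∞ := Order.height P

/-- The residue semifield `κ(P)`: the total semiring of fractions of `A / P`. -/
abbrev ResidueSemifield {A : Type*} [CommSemiring A] (P : PrimeCon A) : Type _ :=
  Localization (nonZeroDivisors P.1.Quotient)

/-- The canonical homomorphism `A → A / P → κ(P)`, written `a ↦ |a|_P`. -/
def residueMap {A : Type*} [CommSemiring A] (P : PrimeCon A) : A →+* ResidueSemifield P :=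
  (algebraMap P.1.Quotient (ResidueSemifield P)).comp P.1.mk'

/-- If `A` is an `S`-algebra then `κ(P)` is an `S`-algebra through `S → A → κ(P)`. -/
theorem algebraMap_residueSemifield {S A : Type*} [CommSemiring S] [CommSemiring A] [Algebra S A]
    (P : PrimeCon A) :
    algebraMap S (ResidueSemifield P) = (residueMap P).comp (algebraMap S A) := rfl

/-- The preorder `≤_P` on `A`: `a ≤_P b` iff `|a|_P ≤ |b|_P` in `A / P`. -/
def PrimeCon.LE {A : Type*} [CommSemiring A] (P : PrimeCon A) (a b : A) : Prop :=
  CanonLE (P.1.mk' a) (P.1.mk' b)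

/-! ### The continuous spectrum -/

/-- The canonical topology of a totally ordered semifield `L`: nonzero elements are isolated and
the sets `{x | x < c}`, `c ≠ 0`, are the basic neighbourhoods of `0`. -/
abbrev semifieldTopology (L : Type*) [CommSemiring L] : TopologicalSpace L :=
  TopologicalSpace.generateFrom
    ({U | ∃ c : L, c ≠ 0 ∧ U = {c}} ∪ {U | ∃ c : L, c ≠ 0 ∧ U = {x | CanonLT x c}})

/-- The topology of an algebra `A` over a totally ordered semifield `S`: the finest topology for
which `A` is a topological semiring and the structure map `S → A` is continuous. -/
abbrev algebraTopology (S A : Type*) [CommSemiring S] [CommSemiring A] [Algebra S A] :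
    TopologicalSpace A :=
  sInf {τ | @IsTopologicalSemiring A τ _ ∧ Continuous[semifieldTopology S, τ] (algebraMap S A)}

/-- The continuous spectrum `Cont_S A`: the prime congruences `P` of `A` such that `A / P` is not
finite and the canonical map `A → κ(P)` is continuous. -/
def Cont (S A : Type*) [CommSemiring S] [CommSemiring A] [Algebra S A] : Set (PrimeCon A) :=
  {P | Infinite P.1.Quotient ∧
    Continuous[algebraTopology S A, semifieldTopology (ResidueSemifield P)] (residueMap P)}

/-! ### Transcendence degree of extensions of totally ordered semifields -/

/-- The term of the polynomial `f` at exponent `m`, evaluated at the point `x`. -/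
def termAt {S L ι : Type*} [CommSemiring S] [CommSemiring L] [Algebra S L]
    (f : MvPolynomial ι S) (x : ι → L) (m : ι →₀ ℕ) : L :=
  algebraMap S L (f.coeff m) * m.prod (fun i k => x i ^ k)

open Classical in
/-- `f` vanishes tropically at `x`: deleting any one term of `f` does not change the value at `x`.
For `L` totally ordered this says that the maximum of the terms of `f` at `x` is attained at least
twice, or is `0`. -/
def TropVanishes {S L ι : Type*} [CommSemiring S] [CommSemiring L] [Algebra S L]
    (f : MvPolynomial ι S) (x : ι → L) : Prop :=
  ∀ m ∈ f.support, ∑ m' ∈ f.support \ {m}, termAt f x m' = ∑ m' ∈ f.support, termAt f x m'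

/-- A set of elements of `L` is algebraically independent over `S` if no nonzero polynomial over `S`
vanishes tropically at it. -/
def AlgIndep (S : Type*) {L : Type*} [CommSemiring S] [CommSemiring L] [Algebra S L]
    (B : Set L) : Prop :=
  ∀ f : MvPolynomial B S, TropVanishes f (fun b => (b : L)) → f = 0

/-- The transcendence degree of `L` over `S`: the supremum of the cardinalities of the
algebraically independent subsets of `L`. -/
def trdeg (S : Type*) (L : Type*) [CommSemiring S] [CommSemiring L] [Algebra S L] : Cardinal :=
  ⨆ B : {B : Set L // AlgIndep S B}, Cardinal.mk B.1

/-- The rank of an abelian group: the supremum of the cardinalities of its `ℤ`-linearly independent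
subsets. -/
def groupRank (G : Type*) [CommGroup G] : Cardinal := Module.rank ℤ (Additive G)

/-- The quotient group `Lˣ / Sˣ` of the unit groups of an extension of semifields, where `Sˣ` stands
for its image in `Lˣ`. -/
abbrev UnitsQuotient (S L : Type*) [CommSemiring S] [CommSemiring L] [Algebra S L] : Type _ :=
  Lˣ ⧸ (Units.map (algebraMap S L : S →* L)).range

/-- The rank of the abelian group `Lˣ / Sˣ`. -/
def unitsRank (S L : Type*) [CommSemiring S] [CommSemiring L] [Algebra S L] : Cardinal :=
  groupRank (UnitsQuotient S L)

/-! ### The tropical semifield and its sub-semifields -/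

/-- The tropical semifield `ℝ ∪ {-∞}` with maximum as addition and `+` as multiplication. Mathlib's
`Tropical` takes minima as addition, so it is applied to the order dual of `ℝ` with a top element
(that is, `-∞`) adjoined. Only the canonical order `CanonLE` is used on it. -/
abbrev 𝕋 : Type := Tropical (WithTop ℝᵒᵈ)

/-- The element `t ^ a` of the tropical semifield that corresponds to the real number `a`. -/
def tpow (a : ℝ) : 𝕋 := Tropical.trop ((OrderDual.toDual a : ℝᵒᵈ) : WithTop ℝᵒᵈ)

/-- The element of `ℝ ∪ {-∞}` that corresponds to an element of the tropical semifield. -/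
def log (a : 𝕋) : WithBot ℝ := WithTop.ofDual (Tropical.untrop a)

/-- `S` is a sub-semifield of the tropical semifield, different from the Boolean semifield
`{0, 1}`. -/
structure IsSubsemifield (S : Subsemiring 𝕋) : Prop where
  exists_inv : ∀ a ∈ S, a ≠ 0 → ∃ b ∈ S, a * b = 1
  ne_boolean : ∃ a ∈ S, a ≠ 0 ∧ a ≠ 1

/-- The value group `Γ = log (Sˣ)`. -/
def valueGroup (S : Subsemiring 𝕋) : Set ℝ := {γ | tpow γ ∈ S}

/-! ### Polyhedra in `N_ℝ = Hom(M, ℝ)` -/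

section Polyhedra

variable {M : Type*} [AddCommGroup M]

/-- A `Γ`-rational polyhedron in `Hom(M, ℝ)`: a set cut out by finitely many inequalities
`⟨x, uᵢ⟩ ≤ γᵢ` with `uᵢ ∈ M` and `γᵢ ∈ Γ`. -/
def IsRationalPolyhedron (Γ : Set ℝ) (Q : Set (M →+ ℝ)) : Prop :=
  ∃ (q : ℕ) (u : Fin q → M) (γ : Fin q → ℝ),
    (∀ i, γ i ∈ Γ) ∧ Q = {x | ∀ i, x (u i) ≤ γ i}

/-- A `Γ`-rational polyhedral set: a finite union of `Γ`-rational polyhedra. -/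
def IsRationalPolyhedralSet (Γ : Set ℝ) (U : Set (M →+ ℝ)) : Prop :=
  ∃ (r : ℕ) (Q : Fin r → Set (M →+ ℝ)), (∀ i, IsRationalPolyhedron Γ (Q i)) ∧ U = ⋃ i, Q i

/-- The dimension of a polyhedral set: the largest dimension (of the affine span) of a nonempty
convex subset, and `⊥` for the empty set. For a polyhedron it is the dimension of its affine span;
for a finite union of polyhedra it is the largest of their dimensions. -/
def polyDim (U : Set (M →+ ℝ)) : WithBot ℕ∞ :=
  ⨆ C : {C : Set (M →+ ℝ) // C ⊆ U ∧ Convex ℝ C ∧ C.Nonempty},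
    (((Module.finrank ℝ (vectorSpan ℝ C.1) : ℕ) : ℕ∞) : WithBot ℕ∞)

variable {S : Subsemiring 𝕋}

/-- The value `f(x) = max_u (log f_u + ⟨x, u⟩)` in `ℝ ∪ {-∞}` of `f ∈ S[M]` at `x ∈ Hom(M, ℝ)`. -/
def evalAt (f : AddMonoidAlgebra S M) (x : M →+ ℝ) : WithBot ℝ :=
  f.coeff.support.sup (fun u => log (f.coeff u : 𝕋) + ((x u : ℝ) : WithBot ℝ))

/-- The rational set `R(f₀, f₁, …, fₙ) = {x | f₀(x) ≥ fᵢ(x) for 1 ≤ i ≤ n}`. -/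
def rationalSet (f₀ : AddMonoidAlgebra S M) {n : ℕ} (f : Fin n → AddMonoidAlgebra S M) :
    Set (M →+ ℝ) :=
  {x | ∀ i, evalAt (f i) x ≤ evalAt f₀ x}

/-- The filter `ℱ_P`: the `Γ`-rational polyhedral sets that contain a rational set
`R(f₀, f₁, …, fₙ)` with `|f₀|_P ≥ |fᵢ|_P` for all `i`. -/
def primeFilter (P : PrimeCon (AddMonoidAlgebra S M)) : Set (Set (M →+ ℝ)) :=
  {U | IsRationalPolyhedralSet (valueGroup S) U ∧
    ∃ (n : ℕ) (f₀ : AddMonoidAlgebra S M) (f : Fin n → AddMonoidAlgebra S M),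
      rationalSet f₀ f ⊆ U ∧ ∀ i, P.LE (f i) f₀}

end Polyhedra

end TropCont

end

/-! Modulo a prime congruence $P$, every nonzero element of $S[M]$ equals its leading monomial
(`exists_leading_monomial`). Monomials form the group $\Gamma\times M$ and are units, so $S[M]/P$ is
already a semifield. Its unit group is an ordered group, onto which $\Gamma\times M$ maps by `val`,
and $P$ is determined by the preorder pulled back along `val`. Since $\Gamma$ is nonzero and
archimedean, continuity forces `val` to be injective on $\Gamma$ (`sharp_of_mem_cont`).

Let $N\subseteq M$ be the group of exponents $u$ for which $\chi^u$ is congruent to a scalar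
(`scalarExponents`). The height is $\operatorname{rk}N$, and the other three invariants all equal
$\operatorname{rk}(M/N)$.

Unit group: $M\to\kappa(P)^\times/S^\times$ is surjective with kernel $N$.

Height: along a strict inclusion of primes the rank of $N$ drops strictly
(`finrank_scalarExponents_lt`). Conversely, refining the order lexicographically by an integral
functional nonzero on $N$ gives a smaller prime for which the rank drops by at most one
(`exists_lt_of_finrank_pos`).

Dimension: each member of $\mathcal F_P$ contains the locus where finitely many monomials of value
$\le 0$ are nonpositive. Fourier–Motzkin elimination finds a point there at which those of value $0$
vanish and the others are strictly negative. The point can then be moved in every direction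
annihilating $N$ (`exists_convex_of_val_nonpos`). The bound is attained by the polyhedron cut out by
the equations of a basis of $N$ (`exists_polyhedron_mem_primeFilter`).

Transcendence degree: a family of units is algebraically independent exactly when its classes in
$\kappa(P)^\times/S^\times$ are linearly independent, since two equal terms give a vanishing
binomial (`tropVanishes_imp_eq_zero_iff`). -/

noncomputable section

namespace TropCont

/-! ### The canonical order -/

section CanonLE

variable {R R' : Type*} [CommSemiring R] [CommSemiring R']

theorem CanonLE.trans {a b c : R} (hab : CanonLE a b) (hbc : CanonLE b c) : CanonLE a c := by
  unfold CanonLE at *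
  rw [← hbc, ← add_assoc, hab]

theorem CanonLE.antisymm {a b : R} (hab : CanonLE a b) (hba : CanonLE b a) : a = b := by
  unfold CanonLE at *
  rw [← hba, add_comm, hab]

theorem CanonLE.mul_left {a b : R} (c : R) (h : CanonLE a b) : CanonLE (c * a) (c * b) := by
  unfold CanonLE at *
  rw [← mul_add, h]

theorem CanonLE.map {a b : R} (f : R →+* R') (h : CanonLE a b) : CanonLE (f a) (f b) := by
  unfold CanonLE at *
  rw [← map_add, h]

theorem canonLE_refl (tot : ∀ a b : R, CanonLE a b ∨ CanonLE b a) (a : R) : CanonLE a a :=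
  (tot a a).elim id id

theorem zero_canonLE (a : R) : CanonLE 0 a := zero_add a

/-- Totality makes addition the maximum of two elements; induction extends this to nonempty finite
sums. -/
theorem exists_sum_eq (tot : ∀ a b : R, CanonLE a b ∨ CanonLE b a) {ι : Type*} {s : Finset ι}
    (hs : s.Nonempty) (f : ι → R) :
    ∃ i ∈ s, ∑ j ∈ s, f j = f i ∧ ∀ j ∈ s, CanonLE (f j) (f i) := by
  classical
  induction hs using Finset.Nonempty.cons_induction with
  | singleton a => exact ⟨a, by simp, by simp, by simpa using canonLE_refl tot _⟩
  | cons a s ha hs ih =>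
    obtain ⟨i, hi, hsum, hle⟩ := ih
    rcases tot (f a) (f i) with h | h
    · refine ⟨i, Finset.mem_cons_of_mem hi, ?_, ?_⟩
      · rw [Finset.sum_cons, hsum]; exact h
      · simpa [Finset.mem_cons] using ⟨h, hle⟩
    · refine ⟨a, Finset.mem_cons_self _ _, ?_, ?_⟩
      · rw [Finset.sum_cons, hsum, add_comm]; exact h
      · simpa [Finset.mem_cons] using ⟨canonLE_refl tot _, fun j hj => (hle j hj).trans h⟩

end CanonLE

/-! ### Elements of the tropical semifield -/

theorem tpow_ne_zero (a : ℝ) : tpow a ≠ 0 := by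
  intro h
  have := congrArg Tropical.untrop h
  simp [tpow] at this

theorem tpow_zero : tpow 0 = 1 := rfl

theorem tpow_add (a b : ℝ) : tpow (a + b) = tpow a * tpow b := rfl

theorem tpow_injective : Function.Injective tpow := by
  intro a b h
  have := congrArg Tropical.untrop h
  simpa [tpow] using this

theorem exists_eq_tpow {a : 𝕋} (ha : a ≠ 0) : ∃ γ, a = tpow γ := by
  induction a using Tropical.tropRec with
  | h a =>
    induction a using WithTop.recTopCoe with
    | top => exact absurd rfl ha
    | coe a => exact ⟨OrderDual.ofDual a, rfl⟩

theorem tpow_add_tpow_of_le {a b : ℝ} (h : a ≤ b) : tpow a + tpow b = tpow b := by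
  apply Tropical.add_eq_right
  rw [← Tropical.untrop_le_iff]
  simpa [tpow] using h

section ValueGroup

variable {S : Subsemiring 𝕋}

/-- The value group of a sub-semifield, as a group of real numbers. -/
def valueSubgroup (hS : IsSubsemifield S) : AddSubgroup ℝ where
  carrier := valueGroup S
  zero_mem' := by
    change tpow 0 ∈ S
    rw [tpow_zero]; exact S.one_mem
  add_mem' {a b} ha hb := by
    change tpow (a + b) ∈ S
    rw [tpow_add]; exact S.mul_mem ha hb
  neg_mem' {a} ha := by
    change tpow (-a) ∈ S
    obtain ⟨b, hb, hab⟩ := hS.exists_inv _ ha (tpow_ne_zero a)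
    have : b = tpow (-a) := by
      calc b = tpow (-a + a) * b := by rw [neg_add_cancel, tpow_zero, one_mul]
        _ = tpow (-a) := by rw [tpow_add, mul_assoc, hab, mul_one]
    rwa [← this]

variable {hS : IsSubsemifield S}

/-- The element of `S` with a given logarithm. -/
def scalar (γ : valueSubgroup hS) : S := ⟨tpow γ, γ.2⟩

theorem scalar_ne_zero (γ : valueSubgroup hS) : scalar γ ≠ 0 :=
  fun h => tpow_ne_zero _ (congrArg Subtype.val h)

theorem scalar_injective : Function.Injective (scalar : valueSubgroup hS → S) :=
  fun _ _ h => Subtype.ext (tpow_injective (congrArg Subtype.val h))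

theorem scalar_zero : scalar (0 : valueSubgroup hS) = 1 := rfl

theorem scalar_add (γ δ : valueSubgroup hS) : scalar (γ + δ) = scalar γ * scalar δ := rfl

theorem exists_eq_scalar (hS : IsSubsemifield S) {s : S} (hs : s ≠ 0) :
    ∃ γ : valueSubgroup hS, s = scalar γ := by
  obtain ⟨γ, hγ⟩ := exists_eq_tpow (a := (s : 𝕋)) (fun h => hs (Subtype.ext h))
  have hm : tpow γ ∈ S := hγ ▸ s.2
  exact ⟨⟨γ, hm⟩, Subtype.ext hγ⟩

theorem scalar_canonLE {γ δ : valueSubgroup hS} (h : γ ≤ δ) : CanonLE (scalar γ) (scalar δ) :=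
  Subtype.ext (tpow_add_tpow_of_le h)

end ValueGroup

/-! ### Monomials -/

section Monomials

variable {M : Type*} [AddCommGroup M] {S : Subsemiring 𝕋} (hS : IsSubsemifield S)

/-- The group of monomials of `S[M]`. -/
def monomialHom : Multiplicative (valueSubgroup hS × M) →* AddMonoidAlgebra S M where
  toFun g := AddMonoidAlgebra.single g.toAdd.2 (scalar g.toAdd.1)
  map_one' := rfl
  map_mul' g h := by
    rw [AddMonoidAlgebra.single_mul_single]; rfl

/-- The monomial of `S[M]` with a given exponent and a given logarithm of the coefficient. -/
def mono (g : valueSubgroup hS × M) : AddMonoidAlgebra S M :=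
  monomialHom hS (Multiplicative.ofAdd g)

theorem mono_def (g : valueSubgroup hS × M) :
    mono hS g = AddMonoidAlgebra.single g.2 (scalar g.1) := rfl

theorem mono_zero : mono hS (0 : valueSubgroup hS × M) = 1 := rfl

theorem mono_fst (γ : valueSubgroup hS) :
    mono hS ((γ, 0) : valueSubgroup hS × M) = algebraMap S _ (scalar γ) := by
  rw [mono_def, AddMonoidAlgebra.coe_algebraMap]; rfl

theorem isUnit_mono (g : valueSubgroup hS × M) : IsUnit (mono hS g) :=
  (Group.isUnit (Multiplicative.ofAdd g)).map (monomialHom hS)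

/-- The monomials that occur in an element of `S[M]`. -/
def monomials (f : AddMonoidAlgebra S M) : Set (valueSubgroup hS × M) :=
  {g | f.coeff g.2 = scalar g.1}

omit [AddCommGroup M] in
theorem finite_monomials (f : AddMonoidAlgebra S M) : (monomials hS f).Finite := by
  refine Set.Finite.of_finite_image (f := Prod.snd) (f.coeff.support.finite_toSet.subset ?_) ?_
  · rintro _ ⟨g, hg, rfl⟩
    have hg : f.coeff g.2 = scalar g.1 := hg
    simpa [hg] using scalar_ne_zero g.1
  · intro g hg h hh hgh
    have hg : f.coeff g.2 = scalar g.1 := hg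
    have hh : f.coeff h.2 = scalar h.1 := hh
    have : scalar g.1 = scalar h.1 := by rw [← hg, ← hh, hgh]
    exact Prod.ext (scalar_injective this) hgh

/-- An element is the sum of its monomials, and in a totally ordered target a sum is its largest
term. This reduces questions about congruences to the group of monomials. -/
theorem exists_leading_monomial {R : Type*} [CommSemiring R]
    (tot : ∀ a b : R, CanonLE a b ∨ CanonLE b a) (φ : AddMonoidAlgebra S M →+* R)
    {f : AddMonoidAlgebra S M} (hf : f ≠ 0) :
    ∃ g ∈ monomials hS f, φ f = φ (mono hS g) ∧
      ∀ g' ∈ monomials hS f, CanonLE (φ (mono hS g')) (φ (mono hS g)) := by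
  have hsum : φ f = ∑ u ∈ f.coeff.support, φ (AddMonoidAlgebra.single u (f.coeff u)) := by
    conv_lhs => rw [← AddMonoidAlgebra.sum_coeff_single f, Finsupp.sum, map_sum]
  obtain ⟨u, hu, hfu, hle⟩ := exists_sum_eq tot (s := f.coeff.support)
    (Finsupp.support_nonempty_iff.2 (by simpa using hf))
    (fun u => φ (AddMonoidAlgebra.single u (f.coeff u)))
  obtain ⟨γ, hγ⟩ := exists_eq_scalar hS (Finsupp.mem_support_iff.1 hu)
  refine ⟨(γ, u), hγ, by rw [hsum, hfu, hγ]; rfl, fun g' hg' => ?_⟩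
  have hg' : f.coeff g'.2 = scalar g'.1 := hg'
  have := hle g'.2 (by simpa [hg'] using scalar_ne_zero g'.1)
  rwa [hg', hγ] at this

theorem evalAt_le_iff (f : AddMonoidAlgebra S M) (x : M →+ ℝ) (c : WithBot ℝ) :
    evalAt f x ≤ c ↔ ∀ g ∈ monomials hS f, (((g.1 : ℝ) + x g.2 : ℝ) : WithBot ℝ) ≤ c := by
  rw [evalAt, Finset.sup_le_iff]
  constructor
  · intro h g hg
    have hg : f.coeff g.2 = scalar g.1 := hg
    have := h g.2 (by simpa [hg] using scalar_ne_zero g.1)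
    rw [hg] at this
    exact this
  · intro h u hu
    obtain ⟨γ, hγ⟩ := exists_eq_scalar hS (Finsupp.mem_support_iff.1 hu)
    have := h (γ, u) hγ
    rw [hγ]
    exact this

theorem le_evalAt {f : AddMonoidAlgebra S M} {g : valueSubgroup hS × M}
    (hg : g ∈ monomials hS f) (x : M →+ ℝ) : (((g.1 : ℝ) + x g.2 : ℝ) : WithBot ℝ) ≤ evalAt f x :=
  (evalAt_le_iff hS f x _).1 le_rfl g hg

theorem mem_monomials_mono (g h : valueSubgroup hS × M) :
    h ∈ monomials hS (mono hS g) ↔ h = g := by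
  classical
  rw [monomials, Set.mem_ofPred_eq, mono_def, AddMonoidAlgebra.coeff_single, Finsupp.single_apply]
  constructor
  · intro hh
    split_ifs at hh with he
    · exact Prod.ext (scalar_injective hh.symm) he.symm
    · exact absurd hh.symm (scalar_ne_zero _)
  · rintro rfl
    simp

theorem evalAt_mono (g : valueSubgroup hS × M) (x : M →+ ℝ) :
    evalAt (mono hS g) x = (((g.1 : ℝ) + x g.2 : ℝ) : WithBot ℝ) := by
  refine le_antisymm ((evalAt_le_iff hS _ _ _).2 fun h hh => ?_)
    (le_evalAt hS ((mem_monomials_mono hS _ _).2 rfl) x)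
  rw [(mem_monomials_mono hS _ _).1 hh]

end Monomials


/-! ### The residue semifield of a prime congruence -/

section Residue

variable {M : Type*} [AddCommGroup M] {S : Subsemiring 𝕋} (hS : IsSubsemifield S)
  (P : PrimeCon (AddMonoidAlgebra S M))

theorem PrimeCon.zero_ne_one {A : Type*} [CommSemiring A] (P : PrimeCon A) :
    (0 : P.1.Quotient) ≠ 1 := by
  intro h
  apply P.2.ne_top
  refine top_le_iff.1 fun a b _ => (RingCon.eq _).1 ?_
  have key : ∀ c : P.1.Quotient, c = 0 := fun c => by rw [← mul_one c, ← h, mul_zero]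
  rw [key a, key b]

include hS in
-- The class equals that of a leading monomial, which is a unit. Hence passing to $\kappa(P)$ adds
-- nothing to $S[M]/P$.
theorem isUnit_mk_of_ne_zero {a : P.1.Quotient} (ha : a ≠ 0) : IsUnit a := by
  obtain ⟨f, rfl⟩ := RingCon.mk'_surjective P.1 a
  have hf : f ≠ 0 := by rintro rfl; exact ha (map_zero _)
  obtain ⟨g, -, hg, -⟩ := exists_leading_monomial hS P.2.total P.1.mk' hf
  rw [hg]
  exact (isUnit_mono hS g).map _

theorem mk_mono_ne_zero (g : valueSubgroup hS × M) : P.1.mk' (mono hS g) ≠ 0 := by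
  intro h
  have hu := (isUnit_mono hS g).map P.1.mk'
  rw [h, isUnit_zero_iff] at hu
  exact P.zero_ne_one hu

include hS in
theorem nonZeroDivisors_le_isUnit :
    nonZeroDivisors P.1.Quotient ≤ IsUnit.submonoid P.1.Quotient := by
  intro a ha
  refine isUnit_mk_of_ne_zero hS P ?_
  rintro rfl
  have := (mem_nonZeroDivisors_iff_right.1 ha) 1 (mul_zero 1)
  exact P.zero_ne_one this.symm

include hS in
theorem algebraMap_residue_bijective :
    Function.Bijective (algebraMap P.1.Quotient (ResidueSemifield P)) :=
  (IsLocalization.atUnits P.1.Quotient (nonZeroDivisors P.1.Quotient)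
    (S := ResidueSemifield P) (nonZeroDivisors_le_isUnit hS P)).bijective

include hS in
theorem residueMap_surjective : Function.Surjective (residueMap P) :=
  (algebraMap_residue_bijective hS P).2.comp (RingCon.mk'_surjective P.1)

include hS in
theorem residueMap_eq_iff {f g : AddMonoidAlgebra S M} :
    residueMap P f = residueMap P g ↔ P.1 f g :=
  (algebraMap_residue_bijective hS P).1.eq_iff.trans (RingCon.eq _)

include hS in
theorem residueMap_canonLE_iff {f g : AddMonoidAlgebra S M} :
    CanonLE (residueMap P f) (residueMap P g) ↔ P.LE f g := by
  unfold PrimeCon.LE CanonLE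
  rw [← map_add, ← map_add, residueMap_eq_iff hS]
  exact (RingCon.eq _).symm

include hS in
theorem residue_total (a b : ResidueSemifield P) : CanonLE a b ∨ CanonLE b a := by
  obtain ⟨f, rfl⟩ := residueMap_surjective hS P a
  obtain ⟨g, rfl⟩ := residueMap_surjective hS P b
  rw [residueMap_canonLE_iff hS, residueMap_canonLE_iff hS]
  exact P.2.total _ _

theorem residueMap_mono_ne_zero (g : valueSubgroup hS × M) : residueMap P (mono hS g) ≠ 0 := by
  intro h
  rw [← map_zero (residueMap P), residueMap_eq_iff hS] at h
  exact mk_mono_ne_zero hS P g ((RingCon.eq _).2 h)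

theorem exists_residueMap_mono {l : ResidueSemifield P} (hl : l ≠ 0) :
    ∃ g : valueSubgroup hS × M, l = residueMap P (mono hS g) := by
  obtain ⟨f, rfl⟩ := residueMap_surjective hS P l
  have hf : f ≠ 0 := by rintro rfl; exact hl (map_zero _)
  obtain ⟨g, -, hg, -⟩ := exists_leading_monomial hS (residue_total hS P) (residueMap P) hf
  exact ⟨g, hg⟩

/-- The unit group of the residue semifield, written additively, ordered by the canonical order. -/
@[nolint unusedArguments]
def OrdGroup (_ : IsSubsemifield S) (P : PrimeCon (AddMonoidAlgebra S M)) : Type _ :=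
  Additive (ResidueSemifield P)ˣ

instance : AddCommGroup (OrdGroup hS P) := inferInstanceAs (AddCommGroup (Additive _))

open Classical in
instance : LinearOrder (OrdGroup hS P) where
  le a b := CanonLE ((Additive.toMul a : (ResidueSemifield P)ˣ) : ResidueSemifield P)
    (Additive.toMul b : (ResidueSemifield P)ˣ)
  le_refl _ := canonLE_refl (residue_total hS P) _
  le_trans _ _ _ := CanonLE.trans
  le_antisymm _ _ h h' := Units.ext (h.antisymm h')
  le_total _ _ := residue_total hS P _ _
  toDecidableLE := fun _ _ => Classical.dec _

instance : IsOrderedAddMonoid (OrdGroup hS P) where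
  add_le_add_left a b h c := by
    have key := CanonLE.mul_left (Units.val (Additive.toMul c)) h
    rw [mul_comm, mul_comm _ (Units.val (Additive.toMul b))] at key
    exact key

/-- The value of a monomial in the ordered group of a prime congruence. -/
def val : valueSubgroup hS × M →+ OrdGroup hS P :=
  MonoidHom.toAdditiveRight
    (MonoidHom.toHomUnits ((residueMap P : AddMonoidAlgebra S M →* ResidueSemifield P).comp
      (monomialHom hS)))

theorem coe_val (g : valueSubgroup hS × M) :
    ((Additive.toMul (val hS P g) : (ResidueSemifield P)ˣ) : ResidueSemifield P) =
      residueMap P (mono hS g) := rfl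

theorem val_le_val_iff {g h : valueSubgroup hS × M} :
    val hS P g ≤ val hS P h ↔ P.LE (mono hS g) (mono hS h) :=
  residueMap_canonLE_iff hS P

theorem val_eq_val_iff {g h : valueSubgroup hS × M} :
    val hS P g = val hS P h ↔ P.1 (mono hS g) (mono hS h) := by
  rw [← residueMap_eq_iff hS, ← coe_val, ← coe_val, Units.val_inj]
  exact Iff.rfl

theorem val_surjective : Function.Surjective (val hS P) := by
  intro a
  obtain ⟨g, hg⟩ := exists_residueMap_mono hS P
    (l := ((Additive.toMul a : (ResidueSemifield P)ˣ) : ResidueSemifield P)) (by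
      intro h
      have hu := (Additive.toMul a : (ResidueSemifield P)ˣ).isUnit
      rw [h, isUnit_zero_iff] at hu
      apply P.zero_ne_one
      apply (algebraMap_residue_bijective hS P).1
      rw [map_zero, map_one, hu])
  exact ⟨g, Units.ext hg.symm⟩

theorem val_scalar_mono {γ δ : valueSubgroup hS} (h : γ ≤ δ) :
    val hS P (γ, 0) ≤ val hS P (δ, 0) := by
  rw [val_le_val_iff, mono_fst, mono_fst, PrimeCon.LE]
  exact ((scalar_canonLE h).map _).map _

/-- A prime congruence is sharp if it identifies no two different scalars. -/
def Sharp : Prop := ∀ γ : valueSubgroup hS, val hS P (γ, 0) = 0 → γ = 0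

variable {hS P}

theorem neg_of_val_neg {γ : valueSubgroup hS} (h : val hS P (γ, 0) < 0) : γ < 0 := by
  by_contra! h0
  exact absurd h (not_lt.2 ((map_zero (val hS P)).symm.trans_le (val_scalar_mono hS P h0)))

theorem PrimeCon.val_le_of_le {P' : PrimeCon (AddMonoidAlgebra S M)} (h : P' ≤ P)
    {a b : valueSubgroup hS × M} (hab : val hS P' a ≤ val hS P' b) :
    val hS P a ≤ val hS P b := by
  rw [val_le_val_iff] at *
  exact (RingCon.eq _).2 (h ((RingCon.eq _).1 hab))

theorem PrimeCon.val_eq_of_le {P' : PrimeCon (AddMonoidAlgebra S M)} (h : P' ≤ P)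
    {a b : valueSubgroup hS × M} (hab : val hS P' a = val hS P' b) :
    val hS P a = val hS P b :=
  (val_le_of_le h hab.le).antisymm (val_le_of_le h hab.ge)

theorem Sharp.of_le {P' : PrimeCon (AddMonoidAlgebra S M)} (hP : Sharp hS P) (h : P' ≤ P) :
    Sharp hS P' := fun γ hγ => hP γ (by
  have := PrimeCon.val_eq_of_le (hS := hS) h (a := (γ, 0)) (b := 0) (by rw [hγ, map_zero])
  rwa [map_zero] at this)

/-- Inclusion of prime congruences can be tested on the order of monomials: a sufficient
criterion. -/
theorem PrimeCon.le_of_val_le {P' : PrimeCon (AddMonoidAlgebra S M)}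
    (h : ∀ a, val hS P' a ≤ 0 → val hS P a ≤ 0) : P' ≤ P := by
  have hle : ∀ a b, val hS P' a ≤ val hS P' b → val hS P a ≤ val hS P b := by
    intro a b hab
    have := h (a - b) (by rwa [map_sub, sub_nonpos])
    rwa [map_sub, sub_nonpos] at this
  intro f f' hff'
  -- Zero is congruent only to itself, since a nonzero element is congruent to a monomial.
  by_cases hf : f = 0
  · by_cases hf' : f' = 0
    · rw [hf, hf']; exact P.1.refl 0
    · exfalso
      obtain ⟨b, -, hb, -⟩ := exists_leading_monomial hS P'.2.total P'.1.mk' hf'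
      refine mk_mono_ne_zero hS P' b (hb.symm.trans ?_)
      rw [← map_zero P'.1.mk', ← hf]
      exact (RingCon.eq _).2 (P'.1.symm hff')
  have hf' : f' ≠ 0 := by
    rintro rfl
    obtain ⟨b, -, hb, -⟩ := exists_leading_monomial hS P'.2.total P'.1.mk' hf
    refine mk_mono_ne_zero hS P' b (hb.symm.trans ?_)
    rw [← map_zero P'.1.mk']
    exact (RingCon.eq _).2 hff'
  -- The order of `P` on monomials coarsens that of `P'`, so a leading monomial for `P'` is also
  -- leading for `P`.
  have key : ∀ {f : AddMonoidAlgebra S M}, f ≠ 0 →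
      ∃ g, P'.1 f (mono hS g) ∧ P.1 f (mono hS g) := by
    intro f hf
    obtain ⟨g, hg, hfg, hmax⟩ := exists_leading_monomial hS P'.2.total P'.1.mk' hf
    obtain ⟨g₁, hg₁, hfg₁, hmax₁⟩ := exists_leading_monomial hS P.2.total P.1.mk' hf
    refine ⟨g, (RingCon.eq _).1 hfg, (RingCon.eq _).1 (hfg₁.trans ?_)⟩
    refine CanonLE.antisymm ?_ (hmax₁ g hg)
    exact (val_le_val_iff hS P).1 (hle _ _ ((val_le_val_iff hS P').2 (hmax g₁ hg₁)))
  obtain ⟨g, hg', hg⟩ := key hf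
  obtain ⟨g₁, hg₁', hg₁⟩ := key hf'
  have h1 : val hS P' g = val hS P' g₁ :=
    (val_eq_val_iff hS P').2 (P'.1.trans (P'.1.symm hg') (P'.1.trans hff' hg₁'))
  have h2 : val hS P g = val hS P g₁ := (hle _ _ h1.le).antisymm (hle _ _ h1.ge)
  exact P.1.trans hg (P.1.trans ((val_eq_val_iff hS P).1 h2) (P.1.symm hg₁))

end Residue

/-! ### Continuity -/

/-- By induction on the generation of the topology, an open set around $0$ contains all scalars
below some $\delta$. Since $\Gamma\ne 0$, there are nonzero scalars below every $\delta$. -/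
theorem not_isOpen_singleton_zero {S : Subsemiring 𝕋} (hS : IsSubsemifield S) :
    ¬ IsOpen[semifieldTopology S] ({0} : Set S) := by
  have key : ∀ U : Set S, TopologicalSpace.GenerateOpen
      ({U | ∃ c : S, c ≠ 0 ∧ U = {c}} ∪ {U | ∃ c : S, c ≠ 0 ∧ U = {x | CanonLT x c}}) U →
      0 ∈ U → ∃ δ : valueSubgroup hS, ∀ γ < δ, scalar γ ∈ U := by
    intro U hU
    induction hU with
    | basic U hU =>
      intro h0
      rcases hU with ⟨c, hc, rfl⟩ | ⟨c, hc, rfl⟩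
      · exact absurd h0.symm hc
      · obtain ⟨δ, rfl⟩ := exists_eq_scalar hS hc
        refine ⟨δ, fun γ hγ => ⟨scalar_canonLE hγ.le, fun h => hγ.ne ?_⟩⟩
        exact Subtype.ext (tpow_injective (congrArg Subtype.val h))
    | univ => exact fun _ => ⟨0, fun _ _ => trivial⟩
    | inter U V _ _ ihU ihV =>
      intro h0
      obtain ⟨δ, hδ⟩ := ihU h0.1
      obtain ⟨δ', hδ'⟩ := ihV h0.2
      exact ⟨min δ δ', fun γ hγ => ⟨hδ γ (hγ.trans_le (min_le_left _ _)),
        hδ' γ (hγ.trans_le (min_le_right _ _))⟩⟩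
    | sUnion 𝒰 _ ih =>
      rintro ⟨U, hU, h0⟩
      obtain ⟨δ, hδ⟩ := ih U hU h0
      exact ⟨δ, fun γ hγ => ⟨U, hU, hδ γ hγ⟩⟩
  intro h
  obtain ⟨δ, hδ⟩ := key _ h rfl
  obtain ⟨a, ha, ha0, ha1⟩ := hS.ne_boolean
  obtain ⟨α, hα⟩ := exists_eq_scalar hS (s := ⟨a, ha⟩) (fun h => ha0 (congrArg Subtype.val h))
  have hα0 : α ≠ 0 := by
    rintro rfl
    exact ha1 (congrArg Subtype.val hα)
  have hlt : δ - |α| < δ := sub_lt_self _ (abs_pos.2 hα0)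
  exact scalar_ne_zero _ (hδ _ hlt)

theorem continuous_algebraMap_algebraTopology (S A : Type*) [CommSemiring S] [CommSemiring A]
    [Algebra S A] :
    Continuous[semifieldTopology S, algebraTopology S A] (algebraMap S A) :=
  continuous_sInf_rng.2 fun _ h => h.2

/-- Continuity produces one scalar of negative value, and the archimedean property of $\Gamma$ then
excludes a nontrivial scalar of value $0$. -/
theorem sharp_of_mem_cont {M : Type*} [AddCommGroup M] {S : Subsemiring 𝕋}
    (hS : IsSubsemifield S) {P : PrimeCon (AddMonoidAlgebra S M)}
    (hP : P ∈ Cont S (AddMonoidAlgebra S M)) : Sharp hS P := by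
  have hcont : Continuous[semifieldTopology S, semifieldTopology (ResidueSemifield P)]
      ((residueMap P) ∘ (algebraMap S (AddMonoidAlgebra S M))) :=
    @Continuous.comp _ _ _ (semifieldTopology S) (algebraTopology S (AddMonoidAlgebra S M))
      (semifieldTopology (ResidueSemifield P)) _ _ hP.2
      (continuous_algebraMap_algebraTopology S (AddMonoidAlgebra S M))
  have h01 : (1 : ResidueSemifield P) ≠ 0 := by
    rw [← map_one (residueMap P), ← mono_zero hS]
    exact residueMap_mono_ne_zero hS P 0
  have hopen : IsOpen[semifieldTopology (ResidueSemifield P)]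
      {x : ResidueSemifield P | CanonLT x 1} :=
    TopologicalSpace.GenerateOpen.basic _ (Or.inr ⟨1, h01, rfl⟩)
  have hpre := (continuous_def.1 hcont) _ hopen
  obtain ⟨δ, hδ⟩ : ∃ δ : valueSubgroup hS, val hS P (δ, 0) < 0 := by
    -- Without a scalar of negative value, the preimage of $\{x<1\}$ in $S$ would be $\{0\}$, which
    -- is not open.
    by_contra! hno
    apply not_isOpen_singleton_zero hS
    convert hpre using 1
    ext s
    simp only [Set.mem_singleton_iff, Set.mem_preimage, Function.comp_apply, Set.mem_ofPred_eq]
    constructor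
    · rintro rfl
      rw [map_zero, map_zero]
      exact ⟨zero_canonLE _, h01.symm⟩
    · rintro ⟨hle, hne⟩
      by_contra hs
      obtain ⟨γ, rfl⟩ := exists_eq_scalar hS hs
      rw [← mono_fst] at hle hne
      have : val hS P (γ, 0) ≤ 0 := by
        rw [← map_zero (val hS P), val_le_val_iff, ← residueMap_canonLE_iff hS, mono_zero, map_one]
        exact hle
      refine hne ?_
      have h0 := this.antisymm (hno γ)
      rw [← map_zero (val hS P), val_eq_val_iff, ← residueMap_eq_iff hS, mono_zero, map_one] at h0
      exact h0
  have hδ0 : δ < 0 := neg_of_val_neg hδ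
  have key : ∀ γ : valueSubgroup hS, 0 < γ → val hS P (γ, 0) ≠ 0 := by
    intro γ hγ h0
    -- A multiple of $\gamma$ exceeds $-\delta$, whose value is positive, while every multiple of
    -- $\gamma$ has value $0$.
    obtain ⟨n, hn⟩ := exists_lt_nsmul (show (0 : ℝ) < (γ : ℝ) from hγ) (-(δ : ℝ))
    have hle : -δ ≤ n • γ := by
      rw [← Subtype.coe_le_coe]
      simpa using hn.le
    have h1 : val hS P (-δ, 0) ≤ val hS P (n • γ, 0) := val_scalar_mono hS P hle
    have h2 : ((n • γ, 0) : valueSubgroup hS × M) = n • (γ, 0) := by simp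
    have h3 : ((-δ, 0) : valueSubgroup hS × M) = -(δ, 0) := by simp
    rw [h2, h3, map_nsmul, h0, smul_zero, map_neg, neg_nonpos] at h1
    exact h1.not_gt hδ
  intro γ h0
  rcases lt_trichotomy γ 0 with h | h | h
  · exfalso
    refine key (-γ) (neg_pos.2 h) ?_
    have h3 : ((-γ, 0) : valueSubgroup hS × M) = -(γ, 0) := by simp
    rw [h3, map_neg, h0, neg_zero]
  · exact h
  · exact absurd h0 (key γ h)


/-! ### Prime congruences from homomorphisms to ordered groups -/

section TropicalHom

variable {H : Type*} [AddCommGroup H] [LinearOrder H] [IsOrderedAddMonoid H]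

/-- The element of the semifield of an ordered group that corresponds to an element of the group. -/
def expo (h : H) : Tropical (WithTop Hᵒᵈ) :=
  Tropical.trop ((OrderDual.toDual h : Hᵒᵈ) : WithTop Hᵒᵈ)

omit [AddCommGroup H] [LinearOrder H] [IsOrderedAddMonoid H] in
theorem expo_ne_zero (h : H) : expo h ≠ 0 := by
  intro h
  have := congrArg Tropical.untrop h
  simp [expo] at this

omit [LinearOrder H] [IsOrderedAddMonoid H] in
theorem expo_zero : expo (0 : H) = 1 := rfl

omit [LinearOrder H] [IsOrderedAddMonoid H] in
theorem expo_add (a b : H) : expo (a + b) = expo a * expo b := rfl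

omit [AddCommGroup H] [LinearOrder H] [IsOrderedAddMonoid H] in
theorem expo_injective : Function.Injective (expo : H → _) := by
  intro a b h
  have := congrArg Tropical.untrop h
  simpa [expo] using this

omit [AddCommGroup H] [LinearOrder H] [IsOrderedAddMonoid H] in
theorem exists_eq_expo {a : Tropical (WithTop Hᵒᵈ)} (ha : a ≠ 0) : ∃ h : H, a = expo h := by
  induction a using Tropical.tropRec with
  | h a =>
    induction a using WithTop.recTopCoe with
    | top => exact absurd rfl ha
    | coe a => exact ⟨OrderDual.ofDual a, rfl⟩

omit [AddCommGroup H] [IsOrderedAddMonoid H] in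
theorem expo_canonLE {a b : H} (h : a ≤ b) : CanonLE (expo a) (expo b) := by
  apply Tropical.add_eq_right
  rw [← Tropical.untrop_le_iff]
  simpa [expo] using h

theorem expo_canonLE_iff {a b : H} : CanonLE (expo a) (expo b) ↔ a ≤ b := by
  refine ⟨fun h => ?_, expo_canonLE⟩
  by_contra! hlt
  exact hlt.ne (expo_injective (CanonLE.antisymm (expo_canonLE hlt.le) h))

omit [AddCommGroup H] [IsOrderedAddMonoid H] in
theorem tropical_total (a b : Tropical (WithTop Hᵒᵈ)) : CanonLE a b ∨ CanonLE b a :=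
  (le_total b a).imp (fun h => Tropical.add_eq_right h) (fun h => Tropical.add_eq_right h)

omit [LinearOrder H] [IsOrderedAddMonoid H] in
theorem tropical_mul_left_cancel {a b c : Tropical (WithTop Hᵒᵈ)} (ha : a ≠ 0)
    (h : a * b = a * c) : b = c := by
  obtain ⟨x, rfl⟩ := exists_eq_expo ha
  have hx : expo (-x) * expo x = 1 := by rw [← expo_add, neg_add_cancel, expo_zero]
  rw [← one_mul b, ← one_mul c, ← hx, mul_assoc, mul_assoc, h]

/-- The quotient embeds into the semifield of an ordered group and inherits totality and
cancellation. -/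
theorem isPrimeCon_ker {A : Type*} [CommSemiring A] (φ : A →+* Tropical (WithTop Hᵒᵈ)) :
    IsPrimeCon (RingCon.ker φ) where
  ne_top h := by
    have h01 : RingCon.ker φ 0 1 := by rw [h]; trivial
    rw [RingCon.ker_apply, map_zero, map_one, ← expo_zero] at h01
    exact expo_ne_zero _ h01.symm
  total a b := by
    refine (tropical_total (RingCon.kerLift φ a) (RingCon.kerLift φ b)).imp ?_ ?_ <;>
    · intro h
      apply RingCon.kerLift_injective φ
      rw [map_add]
      exact h
  cancel a b c ha h := by
    apply RingCon.kerLift_injective φ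
    refine tropical_mul_left_cancel (a := RingCon.kerLift φ a) ?_ ?_
    · intro h0
      rw [← map_zero (RingCon.kerLift φ)] at h0
      exact ha (RingCon.kerLift_injective φ h0)
    · rw [← map_mul, ← map_mul, h]

variable {M : Type*} [AddCommGroup M] {S : Subsemiring 𝕋} (hS : IsSubsemifield S)

open Classical in
/-- The extension by zero of a map from the value group to a map from the sub-semifield. -/
def scalarFun (w : valueSubgroup hS → H) (s : S) : Tropical (WithTop Hᵒᵈ) :=
  if h : s = 0 then 0 else expo (w (exists_eq_scalar hS h).choose)

omit [AddCommGroup H] [LinearOrder H] [IsOrderedAddMonoid H] in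
theorem scalarFun_zero (w : valueSubgroup hS → H) : scalarFun hS w 0 = 0 := dif_pos rfl

omit [AddCommGroup H] [LinearOrder H] [IsOrderedAddMonoid H] in
theorem scalarFun_scalar (w : valueSubgroup hS → H) (γ : valueSubgroup hS) :
    scalarFun hS w (scalar γ) = expo (w γ) := by
  have h := (exists_eq_scalar hS (scalar_ne_zero γ)).choose_spec
  rw [scalarFun, dif_neg (scalar_ne_zero γ), ← scalar_injective h]

/-- The homomorphism of semifields given by a monotone homomorphism of value groups. -/
def scalarHom (w : valueSubgroup hS →+ H) (hw : Monotone w) :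
    S →+* Tropical (WithTop Hᵒᵈ) where
  toFun := scalarFun hS w
  map_zero' := scalarFun_zero hS w
  map_one' := by rw [← scalar_zero (hS := hS), scalarFun_scalar, map_zero, expo_zero]
  map_mul' a b := by
    by_cases ha : a = 0
    · rw [ha, zero_mul, scalarFun_zero, zero_mul]
    by_cases hb : b = 0
    · rw [hb, mul_zero, scalarFun_zero, mul_zero]
    obtain ⟨α, rfl⟩ := exists_eq_scalar hS ha
    obtain ⟨β, rfl⟩ := exists_eq_scalar hS hb
    rw [← scalar_add, scalarFun_scalar, scalarFun_scalar, scalarFun_scalar, map_add, expo_add]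
  map_add' a b := by
    by_cases ha : a = 0
    · rw [ha, zero_add, scalarFun_zero, zero_add]
    by_cases hb : b = 0
    · rw [hb, add_zero, scalarFun_zero, add_zero]
    obtain ⟨α, rfl⟩ := exists_eq_scalar hS ha
    obtain ⟨β, rfl⟩ := exists_eq_scalar hS hb
    rcases le_total α β with h | h
    · rw [show scalar α + scalar β = scalar β from scalar_canonLE h, scalarFun_scalar,
        scalarFun_scalar]
      exact (expo_canonLE (hw h)).symm
    · rw [add_comm, show scalar β + scalar α = scalar α from scalar_canonLE h, scalarFun_scalar,
        scalarFun_scalar, add_comm]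
      exact (expo_canonLE (hw h)).symm

theorem scalarHom_scalar (w : valueSubgroup hS →+ H) (hw : Monotone w) (γ : valueSubgroup hS) :
    scalarHom hS w hw (scalar γ) = expo (w γ) := scalarFun_scalar hS w γ

/-- The homomorphism `S[M] → T` given by a homomorphism from the group of monomials to an ordered
group that is monotone on scalars. -/
def monomialEval (w : valueSubgroup hS × M →+ H)
    (hw : Monotone (w.comp (AddMonoidHom.inl _ M))) :
    AddMonoidAlgebra S M →+* Tropical (WithTop Hᵒᵈ) :=
  AddMonoidAlgebra.liftNCRingHom (scalarHom hS _ hw)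
    { toFun := fun u => expo (w (0, u.toAdd))
      map_one' := by rw [toAdd_one, Prod.mk_zero_zero, map_zero, expo_zero]
      map_mul' := fun u v => by rw [← expo_add, ← map_add, Prod.mk_add_mk, add_zero]; rfl }
    fun _ _ => Commute.all _ _

theorem monomialEval_mono (w : valueSubgroup hS × M →+ H)
    (hw : Monotone (w.comp (AddMonoidHom.inl _ M))) (g : valueSubgroup hS × M) :
    monomialEval hS w hw (mono hS g) = expo (w g) := by
  have h : monomialEval hS w hw (mono hS g) = scalarHom hS _ hw (scalar g.1) * expo (w (0, g.2)) :=
    AddMonoidAlgebra.liftNC_single _ _ _ _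
  rw [h, scalarHom_scalar, ← expo_add]
  congr 1
  rw [AddMonoidHom.comp_apply, AddMonoidHom.inl_apply, ← map_add, Prod.mk_add_mk, add_zero,
    zero_add]

/-- Prime congruences can thus be prescribed by a group homomorphism on monomials alone; this is
applied to a lexicographic refinement of `val`. -/
theorem val_ker_monomialEval_le_iff (w : valueSubgroup hS × M →+ H)
    (hw : Monotone (w.comp (AddMonoidHom.inl _ M))) (a b : valueSubgroup hS × M) :
    val hS ⟨RingCon.ker (monomialEval hS w hw), isPrimeCon_ker _⟩ a ≤
      val hS ⟨RingCon.ker (monomialEval hS w hw), isPrimeCon_ker _⟩ b ↔ w a ≤ w b := by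
  rw [val_le_val_iff, ← expo_canonLE_iff, ← monomialEval_mono hS w hw, ← monomialEval_mono hS w hw]
  unfold PrimeCon.LE CanonLE
  rw [← map_add, ← map_add]
  exact RingCon.eq _

end TropicalHom

/-! ### The height -/

section Height

variable {M : Type*} [AddCommGroup M] {S : Subsemiring 𝕋} (hS : IsSubsemifield S)
  (P : PrimeCon (AddMonoidAlgebra S M))

/-- The exponents `u` for which `χ^u` is identified with a scalar. -/
def scalarExponents : Submodule ℤ M :=
  AddSubgroup.toIntSubmodule ((val hS P).ker.map (AddMonoidHom.snd _ _))

variable {hS P}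

theorem mem_scalarExponents {u : M} :
    u ∈ scalarExponents hS P ↔ ∃ γ : valueSubgroup hS, val hS P (γ, u) = 0 := by
  constructor
  · rintro ⟨g, hg, rfl⟩
    exact ⟨g.1, hg⟩
  · rintro ⟨γ, hγ⟩
    exact ⟨(γ, u), hγ, rfl⟩

theorem scalarExponents_mono {P' : PrimeCon (AddMonoidAlgebra S M)} (h : P' ≤ P) :
    scalarExponents hS P' ≤ scalarExponents hS P := by
  intro u hu
  obtain ⟨γ, hγ⟩ := mem_scalarExponents.1 hu
  refine mem_scalarExponents.2 ⟨γ, ?_⟩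
  rw [← map_zero (val hS P)]
  exact PrimeCon.val_eq_of_le h (by rw [hγ, map_zero])

/-- The quotient of `N` by `N'` has rank zero, hence is torsion. -/
theorem exists_zsmul_mem_of_finrank_le [Module.Finite ℤ M] {N N' : Submodule ℤ M} (h : N' ≤ N)
    (hr : Module.finrank ℤ N ≤ Module.finrank ℤ N') {u : M} (hu : u ∈ N) :
    ∃ a : ℤ, a ≠ 0 ∧ a • u ∈ N' := by
  have h1 := Submodule.finrank_quotient_add_finrank (N'.comap N.subtype)
  rw [(Submodule.comapSubtypeEquivOfLe h).finrank_eq] at h1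
  have h2 : Module.finrank ℤ (N ⧸ N'.comap N.subtype) = 0 := by omega
  obtain ⟨a, ha, hau⟩ := Module.finrank_eq_zero_iff.1 h2
    (Submodule.Quotient.mk (⟨u, hu⟩ : N))
  refine ⟨a, ha, ?_⟩
  rw [← Submodule.Quotient.mk_smul, Submodule.Quotient.mk_eq_zero] at hau
  exact hau

theorem exists_nsmul_mem_of_zsmul_mem {N : Submodule ℤ M} {a : ℤ} (ha : a ≠ 0) {u : M}
    (h : a • u ∈ N) : ∃ n : ℕ, n ≠ 0 ∧ n • u ∈ N := by
  refine ⟨a.natAbs, by simpa using ha, ?_⟩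
  rw [← natCast_zsmul]
  rcases a.natAbs_eq with h' | h'
  · rwa [← h']
  · rw [h', neg_smul] at h
    exact neg_mem_iff.1 h

/-- If the ranks agreed, the larger exponent group would be torsion modulo the smaller one. A
monomial of value $0$ for `P` would then have a multiple that is a scalar for `P'`. Sharpness makes
that scalar trivial, and ordered groups have no torsion, so `P` would be contained in `P'`. -/
theorem finrank_scalarExponents_lt [Module.Finite ℤ M] (hP : Sharp hS P)
    {P' : PrimeCon (AddMonoidAlgebra S M)} (h : P' < P) :
    Module.finrank ℤ (scalarExponents hS P') < Module.finrank ℤ (scalarExponents hS P) := by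
  by_contra! hr
  refine h.not_ge (PrimeCon.le_of_val_le (hS := hS) fun g hg => ?_)
  by_contra! hlt
  have hge : 0 ≤ val hS P g := by
    have := PrimeCon.val_le_of_le (hS := hS) h.le (a := 0) (b := g) (by rw [map_zero]; exact hlt.le)
    rwa [map_zero] at this
  have h0 : val hS P g = 0 := hg.antisymm hge
  obtain ⟨a, ha, hau⟩ := exists_zsmul_mem_of_finrank_le (scalarExponents_mono h.le) hr
    (mem_scalarExponents.2 ⟨g.1, h0⟩)
  obtain ⟨n, hn, hnu⟩ := exists_nsmul_mem_of_zsmul_mem ha hau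
  obtain ⟨δ, hδ⟩ := mem_scalarExponents.1 hnu
  -- The first summand has value $0$ for both congruences; the second is a scalar, which sharpness
  -- of `P` shows to be trivial.
  have hsplit : n • g = (δ, n • g.2) + (n • g.1 - δ, 0) := by
    ext <;> simp
  have hδP : val hS P (δ, n • g.2) = 0 := by
    rw [← map_zero (val hS P)]
    exact PrimeCon.val_eq_of_le h.le (by rw [hδ, map_zero])
  have h1 : val hS P (n • g.1 - δ, 0) = 0 := by
    have := map_nsmul (val hS P) n g
    rw [h0, smul_zero, hsplit, map_add, hδP, zero_add] at this
    exact this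
  have h2 := hP _ h1
  have h3 : n • val hS P' g = 0 := by
    rw [← map_nsmul, hsplit, map_add, hδ, h2, Prod.mk_zero_zero, map_zero, add_zero]
  exact (nsmul_pos hlt hn).ne' h3

theorem height_le_finrank [Module.Finite ℤ M] (hP : Sharp hS P) :
    P.ht ≤ Module.finrank ℤ (scalarExponents hS P) := by
  induction hn : Module.finrank ℤ (scalarExponents hS P) using Nat.strong_induction_on
    generalizing P with
  | _ n ih =>
    refine Order.height_le_coe_iff.2 fun P' hlt => ?_
    have hr := finrank_scalarExponents_lt hP hlt
    rw [hn] at hr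
    exact (ih _ hr (hP.of_le hlt.le) rfl).trans_lt (by exact_mod_cast hr)

theorem exists_intLinearMap_ne_zero [Module.Free ℤ M] {u : M} (hu : u ≠ 0) :
    ∃ ψ : M →ₗ[ℤ] ℤ, ψ u ≠ 0 := by
  by_contra! h
  exact hu ((Module.Free.chooseBasis ℤ M).forall_coord_eq_zero_iff.1 fun i => h _)

/-- Ties in the order of `P` are broken by an integral functional `ψ` that is nonzero on the
exponent group. The new exponent group contains the kernel of `ψ` on the old one, so its rank is
smaller by at most one. -/
theorem exists_lt_of_finrank_pos [Module.Free ℤ M] [Module.Finite ℤ M]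
    (h : 0 < Module.finrank ℤ (scalarExponents hS P)) :
    ∃ P' < P, Module.finrank ℤ (scalarExponents hS P) ≤
      Module.finrank ℤ (scalarExponents hS P') + 1 := by
  obtain ⟨⟨u, hu⟩, hu0⟩ := Module.finrank_pos_iff_exists_ne_zero.1 h
  obtain ⟨ψ, hψ⟩ := exists_intLinearMap_ne_zero (M := M) (u := u) (fun h => hu0 (Subtype.ext h))
  let w : valueSubgroup hS × M →+ OrdGroup hS P ×ₗ ℤ :=
    { toFun := fun g => toLex (val hS P g, ψ g.2)
      map_zero' := by rw [map_zero, Prod.snd_zero, map_zero]; rfl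
      map_add' := fun g g' => by rw [map_add, Prod.snd_add, map_add]; rfl }
  have hwdef : ∀ g, w g = toLex (val hS P g, ψ g.2) := fun _ => rfl
  -- On scalars the second coordinate is zero, so monotonicity is inherited from `val`.
  have hw : Monotone (w.comp (AddMonoidHom.inl _ M)) := by
    intro γ δ hγδ
    rw [AddMonoidHom.comp_apply, AddMonoidHom.comp_apply, hwdef, hwdef, Prod.Lex.toLex_le_toLex]
    simpa [le_iff_lt_or_eq] using val_scalar_mono hS P hγδ
  let P' : PrimeCon (AddMonoidAlgebra S M) :=
    ⟨RingCon.ker (monomialEval hS w hw), isPrimeCon_ker _⟩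
  have hP' : ∀ a b, val hS P' a ≤ val hS P' b ↔ w a ≤ w b :=
    val_ker_monomialEval_le_iff hS w hw
  have hP'0 : ∀ a, val hS P' a = 0 ↔ w a = 0 := fun a => by
    rw [← map_zero (val hS P'), ← map_zero w, le_antisymm_iff, le_antisymm_iff, hP', hP']
  have hP'w : ∀ a, val hS P' a = 0 ↔ val hS P a = 0 ∧ ψ a.2 = 0 := fun a => by
    rw [hP'0, hwdef]
    exact Prod.mk_eq_zero (M := OrdGroup hS P) (N := ℤ)
  have hle : P' ≤ P := by
    refine PrimeCon.le_of_val_le (hS := hS) fun a ha => ?_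
    rw [← map_zero (val hS P'), hP', hwdef, hwdef, Prod.Lex.toLex_le_toLex, map_zero] at ha
    rcases ha with ha | ha
    · exact ha.le
    · exact ha.1.le
  refine ⟨P', lt_of_le_of_ne hle ?_, ?_⟩
  -- The monomial $(\gamma,u)$ has value $0$ for `P` but not for `P'`, because $\psi(u)\ne 0$.
  · intro he
    obtain ⟨γ, hγ⟩ := mem_scalarExponents.1 hu
    have h1 : val hS P' (γ, u) = 0 := by
      rw [he]; exact hγ
    exact hψ ((hP'w _).1 h1).2
  · set N := scalarExponents hS P with hN
    set N' := scalarExponents hS P' with hN'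
    have h1 := Submodule.finrank_quotient_add_finrank (LinearMap.ker (ψ.comp N.subtype))
    have h2 : Module.finrank ℤ (N ⧸ LinearMap.ker (ψ.comp N.subtype)) ≤ 1 := by
      rw [(ψ.comp N.subtype).quotKerEquivRange.finrank_eq]
      refine (Submodule.finrank_le _).trans_eq (Module.finrank_self ℤ)
    have h3 : Module.finrank ℤ (LinearMap.ker (ψ.comp N.subtype)) ≤ Module.finrank ℤ N' := by
      have hinj : Function.Injective
          (N.subtype.comp (LinearMap.ker (ψ.comp N.subtype)).subtype) :=
        (Submodule.injective_subtype _).comp (Submodule.injective_subtype _)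
      have hmem : ∀ x, N.subtype.comp (LinearMap.ker (ψ.comp N.subtype)).subtype x ∈ N' := by
        rintro ⟨⟨x, hx⟩, hx'⟩
        obtain ⟨γ, hγ⟩ := mem_scalarExponents.1 hx
        exact mem_scalarExponents.2 ⟨γ, (hP'w _).2 ⟨hγ, hx'⟩⟩
      exact LinearMap.finrank_le_finrank_of_injective
        (f := LinearMap.codRestrict N' _ hmem) ((LinearMap.injective_codRestrict_iff hmem).2 hinj)
    omega

theorem finrank_le_height [Module.Free ℤ M] [Module.Finite ℤ M] (n : ℕ)
    (h : n ≤ Module.finrank ℤ (scalarExponents hS P)) : (n : ℕ∞) ≤ P.ht := by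
  induction n generalizing P with
  | zero => exact bot_le
  | succ n ih =>
    obtain ⟨P', hlt, hr⟩ := exists_lt_of_finrank_pos (hS := hS) (P := P) (by omega)
    have h1 := ih (P := P') (by omega)
    have h2 := Order.height_add_one_le hlt
    push_cast
    exact (add_le_add_left h1 1).trans h2

theorem ht_eq_finrank [Module.Free ℤ M] [Module.Finite ℤ M] (hP : Sharp hS P) :
    P.ht = Module.finrank ℤ (scalarExponents hS P) :=
  (height_le_finrank hP).antisymm (finrank_le_height _ le_rfl)

end Height


/-! ### Strict systems of linear inequalities -/

theorem nsmul_mem_of_add_mem {G : Type*} [AddMonoid G] {s : Set G}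
    (hs : ∀ a ∈ s, ∀ b ∈ s, a + b ∈ s) {n : ℕ} (hn : 0 < n) {a : G} (ha : a ∈ s) :
    n • a ∈ s := by
  induction n, hn using Nat.le_induction with
  | base => simpa using ha
  | succ n _ ih => rw [succ_nsmul]; exact hs _ ih _ ha

/-- The value at `y` of an affine form with integral linear part. -/
def affineEval {d : ℕ} (y : Fin d → ℝ) : ℝ × (Fin d → ℤ) →+ ℝ where
  toFun p := p.1 + ∑ i, (p.2 i : ℝ) * y i
  map_zero' := by simp
  map_add' p q := by
    simp only [Prod.fst_add, Prod.snd_add, Pi.add_apply, Int.cast_add, add_mul,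
      Finset.sum_add_distrib]
    ring

theorem affineEval_apply {d : ℕ} (y : Fin d → ℝ) (p : ℝ × (Fin d → ℤ)) :
    affineEval y p = p.1 + ∑ i, (p.2 i : ℝ) * y i := rfl

theorem affineEval_cons {d : ℕ} (t : ℝ) (y : Fin d → ℝ) (p : ℝ × (Fin (d + 1) → ℤ)) :
    affineEval (Fin.cons t y) p = affineEval y (p.1, Fin.tail p.2) + p.2 0 * t := by
  rw [affineEval_apply, affineEval_apply, Fin.sum_univ_succ]
  simp only [Fin.cons_zero, Fin.cons_succ, Fin.tail]
  ring

/-- Fourier–Motzkin elimination: a finite set of affine forms with integral linear part that lies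
in a semigroup whose constant members are negative has a point where all forms are negative. -/
theorem exists_forall_affineEval_neg {d : ℕ} (s : Set (ℝ × (Fin d → ℤ)))
    (hadd : ∀ a ∈ s, ∀ b ∈ s, a + b ∈ s) (hneg : ∀ γ : ℝ, (γ, 0) ∈ s → γ < 0)
    (F : Finset (ℝ × (Fin d → ℤ))) (hF : ∀ p ∈ F, p ∈ s) :
    ∃ y : Fin d → ℝ, ∀ p ∈ F, affineEval y p < 0 := by
  classical
  induction d with
  | zero =>
    refine ⟨0, fun p hp => ?_⟩
    rw [affineEval_apply, Fin.sum_univ_zero, add_zero]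
    apply hneg
    rw [← Subsingleton.elim p.2 0]
    exact hF p hp
  | succ d ih =>
    let tl : ℝ × (Fin (d + 1) → ℤ) → ℝ × (Fin d → ℤ) := fun p => (p.1, Fin.tail p.2)
    -- This combination cancels the first variable when its coefficients in the two forms have
    -- opposite signs. The multipliers are natural numbers so that the result stays in the
    -- semigroup.
    let comb : (ℝ × (Fin (d + 1) → ℤ)) × (ℝ × (Fin (d + 1) → ℤ)) → ℝ × (Fin (d + 1) → ℤ) :=
      fun r => (-r.2.2 0).toNat • r.1 + (r.1.2 0).toNat • r.2
    have htl : ∀ p : ℝ × (Fin (d + 1) → ℤ), p.2 0 = 0 →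
        p = ((tl p).1, Fin.cons 0 (tl p).2) := fun p hp => by
      refine Prod.ext rfl ?_
      conv_lhs => rw [← Fin.cons_self_tail p.2, hp]
    let pos := F.filter fun p => 0 < p.2 0
    let neg := F.filter fun p => p.2 0 < 0
    let nul := F.filter fun p => p.2 0 = 0
    have hcomb : ∀ r ∈ pos ×ˢ neg, comb r ∈ s ∧ (comb r).2 0 = 0 := by
      rintro ⟨p, q⟩ hr
      obtain ⟨hp, hq⟩ := Finset.mem_product.1 hr
      obtain ⟨hpF, hp⟩ := Finset.mem_filter.1 hp
      obtain ⟨hqF, hq⟩ := Finset.mem_filter.1 hq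
      dsimp only at hp hq hpF hqF
      have hq' : 0 < (-q.2 0).toNat := by omega
      have hp' : 0 < (p.2 0).toNat := by omega
      refine ⟨hadd _ (nsmul_mem_of_add_mem hadd hq' (hF _ hpF)) _
        (nsmul_mem_of_add_mem hadd hp' (hF _ hqF)), ?_⟩
      have h1 : ((-q.2 0).toNat : ℤ) = -q.2 0 := Int.toNat_of_nonneg (by omega)
      have h2 : ((p.2 0).toNat : ℤ) = p.2 0 := Int.toNat_of_nonneg (by omega)
      simp only [comb, Prod.snd_add, Prod.smul_snd, Pi.add_apply, Pi.smul_apply]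
      rw [nsmul_eq_mul, nsmul_eq_mul, h1, h2]
      ring
    -- Induction applies to the forms of `s` without the first variable: those in `F` and the
    -- pairwise eliminations.
    obtain ⟨y, hy⟩ := ih {p | (p.1, (Fin.cons 0 p.2 : Fin (d + 1) → ℤ)) ∈ s}
      (fun a ha b hb => by
        have := hadd _ ha _ hb
        rw [Prod.mk_add_mk] at this
        change (a.1 + b.1, (Fin.cons 0 (a.2 + b.2) : Fin (d + 1) → ℤ)) ∈ s
        convert this using 2
        funext i
        refine Fin.cases ?_ (fun i => ?_) i <;> simp)
      (fun γ (hγ : (γ, (Fin.cons 0 0 : Fin (d + 1) → ℤ)) ∈ s) => hneg γ (by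
        convert hγ using 2
        funext i
        refine Fin.cases ?_ (fun i => ?_) i <;> simp))
      (nul.image tl ∪ (pos ×ˢ neg).image (tl ∘ comb)) (by
        intro p hp
        rcases Finset.mem_union.1 hp with hp | hp
        · obtain ⟨q, hq, rfl⟩ := Finset.mem_image.1 hp
          obtain ⟨hqF, hq⟩ := Finset.mem_filter.1 hq
          change _ ∈ s
          rw [← htl q hq]
          exact hF q hqF
        · obtain ⟨r, hr, rfl⟩ := Finset.mem_image.1 hp
          change ((tl (comb r)).1, Fin.cons 0 (tl (comb r)).2) ∈ s
          rw [← htl _ (hcomb r hr).2]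
          exact (hcomb r hr).1)
    -- Forms with negative leading coefficient bound `t` from below, those with positive one from
    -- above. Negativity of the eliminations at `y` says that each lower bound lies below each upper
    -- bound.
    obtain ⟨t, htlo, hthi⟩ := Order.exists_between_finsets
      (neg.image fun q => affineEval y (tl q) / -(q.2 0 : ℝ))
      (pos.image fun p => -affineEval y (tl p) / (p.2 0 : ℝ)) (by
        intro a ha b hb
        obtain ⟨q, hq, rfl⟩ := Finset.mem_image.1 ha
        obtain ⟨p, hp, rfl⟩ := Finset.mem_image.1 hb
        have hpq : (p, q) ∈ pos ×ˢ neg := Finset.mem_product.2 ⟨hp, hq⟩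
        have hc := hy _ (Finset.mem_union_right _ (Finset.mem_image_of_mem (tl ∘ comb) hpq))
        have h0 := affineEval_cons 0 y (comb (p, q))
        have hp' := affineEval_cons 0 y p
        have hq' := affineEval_cons 0 y q
        obtain ⟨-, hp⟩ := Finset.mem_filter.1 hp
        obtain ⟨-, hq⟩ := Finset.mem_filter.1 hq
        have h1 : ((-q.2 0).toNat : ℝ) = -q.2 0 := by
          exact_mod_cast Int.toNat_of_nonneg (by omega : 0 ≤ -q.2 0)
        have h2 : ((p.2 0).toNat : ℝ) = p.2 0 := by
          exact_mod_cast Int.toNat_of_nonneg (by omega : 0 ≤ p.2 0)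
        rw [mul_zero, add_zero] at h0 hp' hq'
        simp only [Function.comp_apply] at hc
        change affineEval y (tl (comb (p, q))) < 0 at hc
        rw [show affineEval y (tl (comb (p, q))) = _ from h0.symm] at hc
        simp only [comb, map_add, map_nsmul] at hc
        rw [nsmul_eq_mul, nsmul_eq_mul, h1, h2, hp', hq'] at hc
        have hp0 : (0 : ℝ) < p.2 0 := by exact_mod_cast hp
        have hq0 : (0 : ℝ) < -q.2 0 := by
          rw [neg_pos]; exact_mod_cast hq
        rw [div_lt_div_iff₀ hq0 hp0]
        simp only [tl]
        linarith)
    refine ⟨Fin.cons t y, fun p hp => ?_⟩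
    rw [affineEval_cons]
    rcases lt_trichotomy (p.2 0) 0 with h | h | h
    · have := htlo _ (Finset.mem_image_of_mem _ (Finset.mem_filter.2 ⟨hp, h⟩))
      have h0 : (0 : ℝ) < -p.2 0 := by
        rw [neg_pos]; exact_mod_cast h
      rw [div_lt_iff₀ h0] at this
      simp only [tl] at this
      linarith
    · have := hy _ (Finset.mem_union_left _
        (Finset.mem_image_of_mem tl (Finset.mem_filter.2 ⟨hp, h⟩)))
      simp only [tl] at this
      rw [h]
      simpa using this
    · have := hthi _ (Finset.mem_image_of_mem _ (Finset.mem_filter.2 ⟨hp, h⟩))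
      have h0 : (0 : ℝ) < p.2 0 := by exact_mod_cast h
      rw [lt_div_iff₀ h0] at this
      simp only [tl] at this
      linarith

/-! ### Real points of finitely generated free abelian groups -/

section RealPoints

variable {M : Type*} [AddCommGroup M] [Module.Free ℤ M] [Module.Finite ℤ M]

/-- Homomorphisms to `ℝ` are given by their values on a basis. -/
def realPointsEquiv (M : Type*) [AddCommGroup M] [Module.Free ℤ M] :
    (M →+ ℝ) ≃ₗ[ℝ] (Module.Free.ChooseBasisIndex ℤ M → ℝ) :=
  (addMonoidHomLequivInt ℝ).trans ((Module.Free.chooseBasis ℤ M).constr ℝ).symm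

instance : Module.Finite ℝ (M →+ ℝ) := Module.Finite.equiv (realPointsEquiv M).symm

theorem finrank_realPoints : Module.finrank ℝ (M →+ ℝ) = Module.finrank ℤ M := by
  rw [(realPointsEquiv M).finrank_eq, Module.finrank_fintype_fun_eq_card,
    Module.finrank_eq_card_chooseBasisIndex]

/-- Evaluation of homomorphisms to `ℝ` at a family of elements. -/
def evalFamily {ι : Type*} (w : ι → M) : (M →+ ℝ) →ₗ[ℝ] (ι → ℝ) where
  toFun x i := x (w i)
  map_add' _ _ := rfl
  map_smul' _ _ := rfl

omit [Module.Free ℤ M] in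
theorem exists_nsmul_mem_span {ι : Type*} [Fintype ι] {w : ι → M} (hw : LinearIndependent ℤ w)
    (hcard : Fintype.card ι = Module.finrank ℤ M) (u : M) :
    ∃ n : ℕ, n ≠ 0 ∧ n • u ∈ Submodule.span ℤ (Set.range w) := by
  obtain ⟨a, ha, hau⟩ := exists_zsmul_mem_of_finrank_le
    (le_top : Submodule.span ℤ (Set.range w) ≤ ⊤)
    (by rw [finrank_span_eq_card hw, hcard, finrank_top]) (Submodule.mem_top (x := u))
  exact exists_nsmul_mem_of_zsmul_mem ha hau

/-- A point vanishing on the family kills a multiple of every element of `M`, hence is zero as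
$\mathbb R$ is torsion-free; dimensions agree. Only maximal rank is required: $M/N$ may have
torsion, so a basis of `N` need not extend to one of `M`. -/
theorem evalFamily_bijective {ι : Type*} [Fintype ι] {w : ι → M} (hw : LinearIndependent ℤ w)
    (hcard : Fintype.card ι = Module.finrank ℤ M) : Function.Bijective (evalFamily w) := by
  have hinj : Function.Injective (evalFamily w) := by
    refine (injective_iff_map_eq_zero _).2 fun x hx => AddMonoidHom.ext fun u => ?_
    obtain ⟨n, hn, hnu⟩ := exists_nsmul_mem_span hw hcard u
    have hle : Submodule.span ℤ (Set.range w) ≤ LinearMap.ker x.toIntLinearMap := by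
      rw [Submodule.span_le]
      rintro _ ⟨i, rfl⟩
      exact congrFun hx i
    have h0 : x (n • u) = 0 := hle hnu
    rw [map_nsmul, nsmul_eq_mul] at h0
    exact (mul_eq_zero.1 h0).resolve_left (by exact_mod_cast hn)
  refine ⟨hinj, (LinearMap.injective_iff_surjective_of_finrank_eq_finrank ?_).1 hinj⟩
  rw [finrank_realPoints, Module.finrank_fintype_fun_eq_card, hcard]

/-- The homomorphisms to `ℝ` that vanish on a subgroup. -/
def annihilatorReal (N : Submodule ℤ M) : Submodule ℝ (M →+ ℝ) where
  carrier := {x | ∀ u ∈ N, x u = 0}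
  zero_mem' _ _ := rfl
  add_mem' {x y} hx hy u hu := by rw [AddMonoidHom.add_apply, hx u hu, hy u hu, add_zero]
  smul_mem' c x hx u hu := by
    change c • x u = 0
    rw [hx u hu, smul_zero]

variable (N : Submodule ℤ M)

omit [Module.Free ℤ M] [Module.Finite ℤ M] in
theorem exists_lift_linearIndependent :
    ∃ e : Fin (Module.finrank ℤ (M ⧸ N)) → M,
      LinearIndependent ℤ (Submodule.Quotient.mk (p := N) ∘ e) := by
  obtain ⟨f, hf⟩ := exists_linearIndependent_of_le_finrank
    (le_refl (Module.finrank ℤ (M ⧸ N)))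
  choose e he using fun i => Submodule.Quotient.mk_surjective N (f i)
  refine ⟨e, ?_⟩
  rwa [show Submodule.Quotient.mk (p := N) ∘ e = f from funext he]

/-- A basis of a subgroup of a finitely generated free abelian group. -/
def subBasis : Module.Basis (Fin (Module.finrank ℤ N)) ℤ N := Module.finBasis ℤ N

/-- A basis of a subgroup together with a family of elements of the group. -/
def adaptedFamily (e : Fin (Module.finrank ℤ (M ⧸ N)) → M) :
    Fin (Module.finrank ℤ N) ⊕ Fin (Module.finrank ℤ (M ⧸ N)) → M :=
  Sum.elim (fun i => (subBasis N i : M)) e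

variable {N}

theorem adaptedFamily_linearIndependent {e : Fin (Module.finrank ℤ (M ⧸ N)) → M}
    (he : LinearIndependent ℤ (Submodule.Quotient.mk (p := N) ∘ e)) :
    LinearIndependent ℤ (adaptedFamily N e) :=
  LinearIndependent.sumElim_of_quotient (subBasis N).linearIndependent e he

omit [Module.Free ℤ M] in
theorem card_adapted :
    Fintype.card (Fin (Module.finrank ℤ N) ⊕ Fin (Module.finrank ℤ (M ⧸ N))) =
      Module.finrank ℤ M := by
  rw [Fintype.card_sum, Fintype.card_fin, Fintype.card_fin, add_comm,
    Submodule.finrank_quotient_add_finrank]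

theorem exists_realPoint {e : Fin (Module.finrank ℤ (M ⧸ N)) → M}
    (he : LinearIndependent ℤ (Submodule.Quotient.mk (p := N) ∘ e))
    (c : Fin (Module.finrank ℤ N) → ℝ) (y : Fin (Module.finrank ℤ (M ⧸ N)) → ℝ) :
    ∃ x : M →+ ℝ, (∀ i, x (subBasis N i) = c i) ∧ ∀ i, x (e i) = y i := by
  obtain ⟨x, hx⟩ := (evalFamily_bijective (adaptedFamily_linearIndependent he) card_adapted).2
    (Sum.elim c y)
  exact ⟨x, fun i => congrFun hx (Sum.inl i), fun i => congrFun hx (Sum.inr i)⟩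

theorem sum_subBasis_repr {u : M} (hu : u ∈ N) :
    ∑ i, (subBasis N).repr ⟨u, hu⟩ i • (subBasis N i : M) = u := by
  have := congrArg N.subtype ((subBasis N).sum_repr ⟨u, hu⟩)
  rwa [map_sum] at this

/-- Evaluation at lifts of a maximal independent family of the quotient is an isomorphism. -/
theorem finrank_annihilatorReal :
    Module.finrank ℝ (annihilatorReal N) = Module.finrank ℤ (M ⧸ N) := by
  obtain ⟨e, he⟩ := exists_lift_linearIndependent N
  have hbij := evalFamily_bijective (adaptedFamily_linearIndependent he) card_adapted
  have key : Function.Bijective ((evalFamily e).comp (annihilatorReal N).subtype) := by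
    constructor
    · intro x y hxy
      refine Subtype.ext (hbij.1 (funext fun i => ?_))
      rcases i with i | i
      · exact (x.2 _ (subBasis N i).2).trans (y.2 _ (subBasis N i).2).symm
      · exact congrFun hxy i
    · intro y
      obtain ⟨x, hx0, hxy⟩ := exists_realPoint he 0 y
      refine ⟨⟨x, fun u hu => ?_⟩, funext hxy⟩
      rw [← sum_subBasis_repr hu, map_sum]
      refine Finset.sum_eq_zero fun i _ => ?_
      rw [map_zsmul, hx0, Pi.zero_apply, smul_zero]
  rw [(LinearEquiv.ofBijective _ key).finrank_eq, Module.finrank_fintype_fun_eq_card,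
    Fintype.card_fin]

end RealPoints


/-! ### Dimensions of the members of the prime filter -/

section Dimension

variable {M : Type*} [AddCommGroup M] {S : Subsemiring 𝕋} {hS : IsSubsemifield S}

/-- The affine functional on `Hom(M, ℝ)` that is given by a monomial. -/
def monoEval (x : M →+ ℝ) : valueSubgroup hS × M →+ ℝ :=
  (valueSubgroup hS).subtype.coprod x

theorem monoEval_apply (x : M →+ ℝ) (g : valueSubgroup hS × M) :
    monoEval x g = (g.1 : ℝ) + x g.2 := rfl

theorem monoEval_combo {x y : M →+ ℝ} {a b : ℝ} (hab : a + b = 1)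
    (g : valueSubgroup hS × M) :
    monoEval (a • x + b • y) g = a * monoEval x g + b * monoEval y g := by
  rw [monoEval_apply, monoEval_apply, monoEval_apply]
  change _ + (a * x g.2 + b * y g.2) = _
  linear_combination -(g.1 : ℝ) * hab

variable (hS) (P : PrimeCon (AddMonoidAlgebra S M))

/-- The points of `Hom(M, ℝ)` that respect the identifications made by a prime congruence. -/
def residuePoints : Set (M →+ ℝ) := {x | ∀ g, val hS P g = 0 → monoEval x g = 0}

variable {hS P}

/-- By sharpness, an exponent in $N$ determines its scalar, so the kernel of `val` is generated by
the lifts of a basis of $N$ and their equations suffice. -/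
theorem mem_residuePoints_of_subBasis [Module.Free ℤ M] [Module.Finite ℤ M] (hP : Sharp hS P)
    {γ : Fin (Module.finrank ℤ (scalarExponents hS P)) → valueSubgroup hS}
    (hγ : ∀ i, val hS P (γ i, subBasis (scalarExponents hS P) i) = 0) {x : M →+ ℝ}
    (hx : ∀ i, monoEval x (γ i, (subBasis (scalarExponents hS P) i : M)) = 0) :
    x ∈ residuePoints hS P := by
  intro g hg
  have hu : g.2 ∈ scalarExponents hS P := mem_scalarExponents.2 ⟨g.1, hg⟩
  set c := (subBasis (scalarExponents hS P)).repr ⟨g.2, hu⟩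
  set k : valueSubgroup hS × M :=
    ∑ i, c i • (γ i, (subBasis (scalarExponents hS P) i : M)) with hk
  have hk2 : k.2 = g.2 := by
    rw [hk, Prod.snd_sum]
    exact sum_subBasis_repr hu
  have hkv : val hS P k = 0 := by
    rw [hk, map_sum]
    exact Finset.sum_eq_zero fun i _ => by rw [map_zsmul, hγ, smul_zero]
  have hkx : monoEval x k = 0 := by
    rw [hk, map_sum]
    exact Finset.sum_eq_zero fun i _ => by rw [map_zsmul, hx, smul_zero]
  have hsplit : g = k + (g.1 - k.1, 0) := by
    ext <;> simp [hk2]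
  have h1 : g.1 - k.1 = 0 := by
    apply hP
    rw [hsplit, map_add, hkv, zero_add] at hg
    exact hg
  rw [hsplit, map_add, hkx, h1, Prod.mk_zero_zero, map_zero, add_zero]

/-- All residue points take the same value at an exponent of $N$, so their differences vanish there.
-/
theorem vectorSpan_le_annihilatorReal [Module.Free ℤ M] [Module.Finite ℤ M]
    {C : Set (M →+ ℝ)} (hC : C ⊆ residuePoints hS P) :
    vectorSpan ℝ C ≤ annihilatorReal (scalarExponents hS P) := by
  rw [vectorSpan_def, Submodule.span_le]
  rintro _ ⟨x, hx, y, hy, rfl⟩ u hu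
  obtain ⟨γ, hγ⟩ := mem_scalarExponents.1 hu
  have h1 := hC hx _ hγ
  have h2 := hC hy _ hγ
  rw [monoEval_apply] at h1 h2
  change x u - y u = 0
  dsimp only at h1 h2
  linarith

/-- The set consists of the residue points at which the monomials of negative value are strictly
negative. It is relatively open in a translate of the annihilator of $N$; the work is to show that
it is nonempty. -/
theorem exists_convex_of_val_nonpos [Module.Free ℤ M] [Module.Finite ℤ M] (hP : Sharp hS P)
    (F : Finset (valueSubgroup hS × M)) (hF : ∀ g ∈ F, val hS P g ≤ 0) :
    ∃ C : Set (M →+ ℝ), Convex ℝ C ∧ C.Nonempty ∧ (∀ x ∈ C, ∀ g ∈ F, monoEval x g ≤ 0) ∧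
      Module.finrank ℤ (M ⧸ scalarExponents hS P) ≤ Module.finrank ℝ (vectorSpan ℝ C) := by
  classical
  set N := scalarExponents hS P with hN
  obtain ⟨e, he⟩ := exists_lift_linearIndependent N
  have hmem : ∀ i, ∃ γ, val hS P (γ, (subBasis N i : M)) = 0 := fun i =>
    mem_scalarExponents.1 (subBasis N i).2
  choose γ hγ using hmem
  let lin : (Fin (Module.finrank ℤ (M ⧸ N)) → ℤ) → M := fun a => ∑ i, a i • e i
  -- These are the forms of negative value in the coordinates given by `e`; the constants among them
  -- are negative because `val` is monotone on $\Gamma$.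
  let s : Set (ℝ × (Fin (Module.finrank ℤ (M ⧸ N)) → ℤ)) :=
    {p | ∃ δ : valueSubgroup hS, (δ : ℝ) = p.1 ∧ val hS P (δ, lin p.2) < 0}
  have hsadd : ∀ a ∈ s, ∀ b ∈ s, a + b ∈ s := by
    rintro a ⟨α, hα, hα'⟩ b ⟨β, hβ, hβ'⟩
    refine ⟨α + β, by rw [AddSubgroup.coe_add, hα, hβ]; rfl, ?_⟩
    have : ((α + β, lin (a + b).2) : valueSubgroup hS × M) = (α, lin a.2) + (β, lin b.2) := by
      simp only [lin, Prod.snd_add, Pi.add_apply, add_smul, Finset.sum_add_distrib,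
        Prod.mk_add_mk]
    rw [this, map_add]
    exact add_neg hα' hβ'
  have hsneg : ∀ c : ℝ, (c, 0) ∈ s → c < 0 := by
    rintro c ⟨δ, hδ, hδ'⟩
    have h0 : lin 0 = 0 := by simp [lin]
    dsimp only at hδ hδ'
    rw [h0] at hδ'
    rw [← hδ]
    exact neg_of_val_neg hδ'
  -- A positive multiple of `g` is an element of the kernel of `val` plus a monomial in the
  -- exponents `e`. The former vanishes at residue points, so the latter decides the sign.
  have hred : ∀ g : valueSubgroup hS × M, val hS P g < 0 → ∃ p ∈ s, ∀ (x : M →+ ℝ)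
      (y : Fin (Module.finrank ℤ (M ⧸ N)) → ℝ), x ∈ residuePoints hS P → (∀ i, x (e i) = y i) →
      affineEval y p < 0 → monoEval x g < 0 := by
    intro g hg
    obtain ⟨n, hn, hnu⟩ := exists_nsmul_mem_span (adaptedFamily_linearIndependent he)
      card_adapted g.2
    obtain ⟨c, hc⟩ := (Submodule.mem_span_range_iff_exists_fun ℤ).1 hnu
    rw [Fintype.sum_sum_type] at hc
    set k : valueSubgroup hS × M := ∑ i, c (Sum.inl i) • (γ i, (subBasis N i : M)) with hk
    have hkv : val hS P k = 0 := by
      rw [hk, map_sum]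
      exact Finset.sum_eq_zero fun i _ => by rw [map_zsmul, hγ, smul_zero]
    have hk2 : k.2 = ∑ i, c (Sum.inl i) • (subBasis N i : M) := by
      rw [hk, Prod.snd_sum]
      rfl
    have hsplit : n • g = k + (n • g.1 - k.1, lin fun i => c (Sum.inr i)) := by
      refine Prod.ext (by simp) ?_
      rw [Prod.smul_snd, ← hc, Prod.snd_add, hk2]
      rfl
    refine ⟨(((n • g.1 - k.1 : valueSubgroup hS) : ℝ), fun i => c (Sum.inr i)),
      ⟨n • g.1 - k.1, rfl, ?_⟩, ?_⟩
    · have h1 : val hS P (n • g) < 0 := by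
        rw [map_nsmul]; exact nsmul_neg hg hn
      rwa [hsplit, map_add, hkv, zero_add] at h1
    · intro x y hx hxy hneg
      have h1 : monoEval x (n • g) < 0 := by
        rw [hsplit, map_add, hx k hkv, zero_add, monoEval_apply]
        rw [affineEval_apply] at hneg
        refine lt_of_eq_of_lt ?_ hneg
        congr 1
        simp only [lin]
        rw [map_sum]
        refine Finset.sum_congr rfl fun i _ => ?_
        rw [map_zsmul, hxy, zsmul_eq_mul]
      rw [map_nsmul, nsmul_eq_mul] at h1
      by_contra! h2
      exact h1.not_ge (mul_nonneg (Nat.cast_nonneg _) h2)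
  choose! p hps hpx using hred
  obtain ⟨y, hy⟩ := exists_forall_affineEval_neg s hsadd hsneg
    ((F.filter fun g => val hS P g < 0).image p) (by
      intro q hq
      obtain ⟨g, hg, rfl⟩ := Finset.mem_image.1 hq
      exact hps g (Finset.mem_filter.1 hg).2)
  obtain ⟨x₀, hx₀, hx₀y⟩ := exists_realPoint he (fun i => -(γ i : ℝ)) y
  have hx₀res : x₀ ∈ residuePoints hS P := mem_residuePoints_of_subBasis hP hγ fun i => by
    rw [monoEval_apply, hx₀, add_neg_cancel]
  have hx₀neg : ∀ g ∈ F, val hS P g < 0 → monoEval x₀ g < 0 := fun g hg hg0 =>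
    hpx g hg0 x₀ y hx₀res hx₀y
      (hy _ (Finset.mem_image_of_mem p (Finset.mem_filter.2 ⟨hg, hg0⟩)))
  let C : Set (M →+ ℝ) :=
    {x | x ∈ residuePoints hS P ∧ ∀ g ∈ F, val hS P g < 0 → monoEval x g < 0}
  have hx₀C : x₀ ∈ C := ⟨hx₀res, hx₀neg⟩
  refine ⟨C, ?_, ⟨x₀, hx₀C⟩, ?_, ?_⟩
  · rintro x ⟨hx, hx'⟩ z ⟨hz, hz'⟩ a b ha hb hab
    refine ⟨fun g hg => ?_, fun g hg hg0 => ?_⟩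
    · rw [monoEval_combo hab, hx g hg, hz g hg, mul_zero, mul_zero, add_zero]
    · rw [monoEval_combo hab]
      exact convex_Iio (𝕜 := ℝ) (0 : ℝ) (hx' g hg hg0) (hz' g hg hg0) ha hb hab
  · rintro x ⟨hx, hx'⟩ g hg
    rcases (hF g hg).lt_or_eq with h | h
    · exact (hx' g hg h).le
    · exact (hx g h).le
  · rw [← finrank_annihilatorReal]
    refine Submodule.finrank_mono fun z hz => ?_
    -- Moving from `x₀` in a direction annihilating $N$ keeps the equations, and a small enough step
    -- keeps the finitely many strict inequalities.
    have hev : ∀ᶠ ε : ℝ in 𝓝[>] 0, ∀ g ∈ F.filter (fun g => val hS P g < 0),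
        monoEval x₀ g + ε * z g.2 < 0 := by
      rw [Filter.eventually_all_finset]
      intro g hg
      obtain ⟨hgF, hg0⟩ := Finset.mem_filter.1 hg
      have hcont : Filter.Tendsto (fun ε : ℝ => monoEval x₀ g + ε * z g.2) (𝓝[>] 0)
          (𝓝 (monoEval x₀ g + 0 * z g.2)) :=
        ((continuous_const.add (continuous_id.mul continuous_const)).tendsto 0).mono_left
          nhdsWithin_le_nhds
      rw [zero_mul, add_zero] at hcont
      exact hcont.eventually_lt_const (hx₀neg g hgF hg0)
    obtain ⟨ε, hε, hε0⟩ := (hev.and self_mem_nhdsWithin).exists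
    have hε0 : (0 : ℝ) < ε := hε0
    have hmono : ∀ g : valueSubgroup hS × M,
        monoEval (x₀ + ε • z) g = monoEval x₀ g + ε * z g.2 := fun g =>
      (add_assoc _ _ _).symm
    have hxC : x₀ + ε • z ∈ C := by
      refine ⟨fun g hg => ?_, fun g hg hg0 => ?_⟩
      · rw [hmono, hx₀res g hg, hz g.2 (mem_scalarExponents.2 ⟨g.1, hg⟩), mul_zero, add_zero]
      · rw [hmono]
        exact hε g (Finset.mem_filter.2 ⟨hg, hg0⟩)
    have hdiff := vsub_mem_vectorSpan ℝ hxC hx₀C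
    rw [vsub_eq_sub, add_sub_cancel_left] at hdiff
    have := Submodule.smul_mem _ ε⁻¹ hdiff
    rwa [smul_smul, inv_mul_cancel₀ hε0.ne', one_smul] at this

/-- The finite set consists of the monomials of the $f_i$ divided by the leading monomial $g_0$ of
$f_0$. Where these are nonpositive, $f_i\le g_0\le f_0$. -/
theorem exists_finset_subset_rationalSet {n : ℕ} {f₀ : AddMonoidAlgebra S M}
    {f : Fin n → AddMonoidAlgebra S M} (hf : ∀ i, P.LE (f i) f₀) :
    ∃ F : Finset (valueSubgroup hS × M), (∀ g ∈ F, val hS P g ≤ 0) ∧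
      ∀ x : M →+ ℝ, (∀ g ∈ F, monoEval x g ≤ 0) → x ∈ rationalSet f₀ f := by
  classical
  -- If $f_0=0$ then all $f_i$ are zero, and the rational set is the whole space.
  by_cases h0 : f₀ = 0
  · have hf0 : ∀ i, f i = 0 := by
      intro i
      by_contra hi
      obtain ⟨g, -, hg, -⟩ := exists_leading_monomial hS P.2.total P.1.mk' hi
      have h1 := (hf i).antisymm (h0 ▸ (map_zero P.1.mk').symm ▸ zero_canonLE _)
      rw [h0, map_zero, hg] at h1
      exact mk_mono_ne_zero hS P g h1
    exact ⟨∅, by simp, fun x _ i => by rw [hf0 i, h0]⟩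
  · obtain ⟨g₀, hg₀, hfg₀, -⟩ := exists_leading_monomial hS P.2.total P.1.mk' h0
    refine ⟨Finset.univ.biUnion fun i => (finite_monomials hS (f i)).toFinset.image (· - g₀),
      ?_, ?_⟩
    · intro g hg
      obtain ⟨i, -, hg⟩ := Finset.mem_biUnion.1 hg
      obtain ⟨g', hg', rfl⟩ := Finset.mem_image.1 hg
      rw [Set.Finite.mem_toFinset] at hg'
      rw [map_sub, sub_nonpos, val_le_val_iff]
      have hi : f i ≠ 0 := by
        intro hi
        have hg' : (f i).coeff g'.2 = scalar g'.1 := hg'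
        rw [hi] at hg'
        exact scalar_ne_zero _ hg'.symm
      obtain ⟨g₁, -, hfg₁, hmax⟩ := exists_leading_monomial hS P.2.total P.1.mk' hi
      have h1 := hf i
      unfold PrimeCon.LE at h1
      rw [hfg₁, hfg₀] at h1
      exact (hmax g' hg').trans h1
    · intro x hx i
      refine (evalAt_le_iff hS _ _ _).2 fun g hg => le_trans ?_ (le_evalAt hS hg₀ x)
      have := hx (g - g₀) (Finset.mem_biUnion.2 ⟨i, Finset.mem_univ _,
        Finset.mem_image_of_mem _ ((Set.Finite.mem_toFinset _).2 hg)⟩)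
      rw [map_sub, sub_nonpos] at this
      exact WithBot.coe_le_coe.2 this

theorem le_polyDim_of_mem_primeFilter [Module.Free ℤ M] [Module.Finite ℤ M] (hP : Sharp hS P)
    {U : Set (M →+ ℝ)} (hU : U ∈ primeFilter P) :
    (((Module.finrank ℤ (M ⧸ scalarExponents hS P) : ℕ) : ℕ∞) : WithBot ℕ∞) ≤ polyDim U := by
  obtain ⟨-, n, f₀, f, hsub, hf⟩ := hU
  obtain ⟨F, hF, hFR⟩ := exists_finset_subset_rationalSet (hS := hS) hf
  obtain ⟨C, hconv, hne, hle, hr⟩ := exists_convex_of_val_nonpos hP F hF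
  have hCU : C ⊆ U := fun x hx => hsub (hFR x (hle x hx))
  refine le_trans ?_ (le_iSup (fun C : {C : Set (M →+ ℝ) // C ⊆ U ∧ Convex ℝ C ∧ C.Nonempty} =>
    (((Module.finrank ℝ (vectorSpan ℝ C.1) : ℕ) : ℕ∞) : WithBot ℕ∞)) ⟨C, hCU, hconv, hne⟩)
  exact_mod_cast hr

theorem exists_polyhedron_mem_primeFilter [Module.Free ℤ M] [Module.Finite ℤ M]
    (hP : Sharp hS P) :
    ∃ Q ∈ primeFilter P, IsRationalPolyhedron (valueGroup S) Q ∧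
      polyDim Q ≤
        (((Module.finrank ℤ (M ⧸ scalarExponents hS P) : ℕ) : ℕ∞) : WithBot ℕ∞) := by
  set N := scalarExponents hS P with hN
  have hmem : ∀ i, ∃ γ, val hS P (γ, (subBasis N i : M)) = 0 := fun i =>
    mem_scalarExponents.1 (subBasis N i).2
  choose γ hγ using hmem
  let b : Fin (Module.finrank ℤ N) → valueSubgroup hS × M := fun i => (γ i, (subBasis N i : M))
  -- The equation of each basis element of $N$ is encoded as two opposite inequalities.
  let a : Fin (Module.finrank ℤ N + Module.finrank ℤ N) → valueSubgroup hS × M :=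
    Fin.append b (-b)
  have ha : ∀ i, val hS P (a i) = 0 := by
    intro i
    refine Fin.addCases (fun i => ?_) (fun i => ?_) i
    · simp only [a, Fin.append_left]
      exact hγ i
    · simp only [a, Fin.append_right, Pi.neg_apply, map_neg]
      exact neg_eq_zero.2 (hγ i)
  let Q : Set (M →+ ℝ) := {x | ∀ i, monoEval x (a i) ≤ 0}
  have hQres : Q ⊆ residuePoints hS P := by
    intro x hx
    refine mem_residuePoints_of_subBasis hP hγ fun i => le_antisymm ?_ ?_
    · have := hx (Fin.castAdd _ i)
      simp only [a, Fin.append_left] at this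
      exact this
    · have := hx (Fin.natAdd _ i)
      simp only [a, Fin.append_right, Pi.neg_apply, map_neg, Left.neg_nonpos_iff] at this
      exact this
  have hQ : IsRationalPolyhedron (valueGroup S) Q := by
    refine ⟨_, fun i => (a i).2, fun i => -(a i).1, fun i => (-(a i).1).2, ?_⟩
    ext x
    refine forall_congr' fun i => ?_
    rw [monoEval_apply]
    constructor <;> intro h <;> linarith
  -- Membership in the filter is witnessed by $f_0=1$ and the monomials `a i`, which have value $0$.
  refine ⟨Q, ⟨⟨1, fun _ => Q, fun _ => hQ, (Set.iUnion_const Q).symm⟩, _, 1,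
    fun i => mono hS (a i), ?_, fun i => ?_⟩, hQ, ?_⟩
  · intro x hx i
    have := hx i
    rw [← mono_zero hS, evalAt_mono, evalAt_mono, WithBot.coe_le_coe] at this
    refine this.trans_eq ?_
    exact map_zero (monoEval (hS := hS) x)
  · rw [← mono_zero hS, ← val_le_val_iff, ha, map_zero]
  · refine iSup_le fun C => ?_
    have h1 := Submodule.finrank_mono
      (vectorSpan_le_annihilatorReal (hS := hS) (P := P) (C.2.1.trans hQres))
    rw [finrank_annihilatorReal] at h1
    exact_mod_cast h1

end Dimension


/-! ### The rank of the unit group and the transcendence degree -/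

/-- The positive and negative parts of an integral relation give two natural combinations with equal
value. -/
theorem linearIndependent_int_of_nat {ι V : Type*} [AddCommGroup V] {v : ι → V}
    (h : LinearIndependent ℕ v) : LinearIndependent ℤ v := by
  refine linearIndependent_iff.2 fun l hl => ?_
  have hcast : ∀ m : ι →₀ ℕ, Finsupp.linearCombination ℤ v (m.mapRange Nat.cast Nat.cast_zero) =
      Finsupp.linearCombination ℕ v m := by
    intro m
    rw [Finsupp.linearCombination_apply, Finsupp.linearCombination_apply,
      Finsupp.sum_mapRange_index fun i => zero_smul ℤ (v i)]
    exact Finsupp.sum_congr fun i _ => natCast_zsmul _ _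
  have hsplit : l = (l.mapRange Int.toNat rfl).mapRange Nat.cast Nat.cast_zero -
      ((-l).mapRange Int.toNat rfl).mapRange Nat.cast Nat.cast_zero := by
    ext i
    simp only [Finsupp.sub_apply, Finsupp.mapRange_apply, Finsupp.neg_apply]
    omega
  rw [hsplit, map_sub, hcast, hcast, sub_eq_zero] at hl
  have heq := h hl
  rw [hsplit, heq, sub_self]

section UnitClasses

/-- The group `Lˣ / Sˣ`, written additively. -/
def UnitClasses (S L : Type*) [CommSemiring S] [CommSemiring L] [Algebra S L] : Type _ :=
  Additive (UnitsQuotient S L)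

variable {S L : Type*} [CommSemiring S] [CommSemiring L] [Algebra S L]

instance : AddCommGroup (UnitClasses S L) :=
  inferInstanceAs (AddCommGroup (Additive (UnitsQuotient S L)))

theorem unitsRank_def : unitsRank S L = Module.rank ℤ (UnitClasses S L) := rfl

variable (S) in
/-- The class of a unit of `L` modulo the units of `S`. -/
def unitClass (a : Lˣ) : UnitClasses S L := Additive.ofMul (QuotientGroup.mk a)

theorem unitClass_one : unitClass S (1 : Lˣ) = 0 := rfl

theorem unitClass_mul (a b : Lˣ) : unitClass S (a * b) = unitClass S a + unitClass S b := rfl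

theorem unitClass_surjective : Function.Surjective (unitClass S : Lˣ → UnitClasses S L) :=
  fun a => by
    obtain ⟨b, hb⟩ := QuotientGroup.mk_surjective (Additive.toMul a)
    exact ⟨b, congrArg Additive.ofMul hb⟩

theorem unitClass_prod_pow {ι : Type*} (β : ι → Lˣ) (m : ι →₀ ℕ) :
    unitClass S (m.prod fun i k => β i ^ k) =
      Finsupp.linearCombination ℕ (fun i => unitClass S (β i)) m := by
  let φ : Lˣ →* Multiplicative (Additive (UnitsQuotient S L)) := QuotientGroup.mk' _
  have h : φ (m.prod fun i k => β i ^ k) = m.prod fun i k => φ (β i) ^ k := by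
    rw [map_finsuppProd]
    exact Finsupp.prod_congr fun i _ => map_pow _ _ _
  exact h

theorem unitClass_eq_iff_mem {a b : Lˣ} : unitClass S a = unitClass S b ↔
    a⁻¹ * b ∈ (Units.map (algebraMap S L : S →* L)).range :=
  QuotientGroup.eq

end UnitClasses

section Rank

variable {M : Type*} [AddCommGroup M] {S : Subsemiring 𝕋} (hS : IsSubsemifield S)
  {P : PrimeCon (AddMonoidAlgebra S M)}

theorem unitClass_eq_iff {a b : (ResidueSemifield P)ˣ} :
    unitClass S a = unitClass S b ↔
      ∃ γ : valueSubgroup hS, b = a * Additive.toMul (val hS P (γ, 0)) := by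
  rw [unitClass_eq_iff_mem]
  constructor
  · rintro ⟨s, hs⟩
    have hs0 : (s : S) ≠ 0 := by
      intro h
      have hu := s.isUnit
      rw [h, isUnit_zero_iff] at hu
      exact scalar_ne_zero (0 : valueSubgroup hS) (hu.symm)
    obtain ⟨γ, hγ⟩ := exists_eq_scalar hS hs0
    refine ⟨γ, ?_⟩
    rw [← inv_mul_eq_iff_eq_mul, ← hs]
    refine Units.ext ?_
    rw [coe_val, mono_fst, ← hγ]
    rfl
  · rintro ⟨γ, rfl⟩
    rw [inv_mul_cancel_left]
    refine ⟨⟨scalar γ, scalar (-γ), ?_, ?_⟩, Units.ext ?_⟩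
    · rw [← scalar_add, add_neg_cancel, scalar_zero]
    · rw [← scalar_add, neg_add_cancel, scalar_zero]
    · rw [coe_val, mono_fst]
      rfl

theorem unitClass_val_scalar (γ : valueSubgroup hS) :
    unitClass S (Additive.toMul (val hS P (γ, 0)) : (ResidueSemifield P)ˣ) = 0 := by
  refine Eq.trans ((unitClass_eq_iff hS).2 ⟨-γ, ?_⟩) unitClass_one
  change (0 : OrdGroup hS P) = val hS P (γ, 0) + val hS P (-γ, 0)
  rw [← map_add, Prod.mk_add_mk, add_neg_cancel, add_zero, Prod.mk_zero_zero, map_zero]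

variable (P) in
/-- The homomorphism that sends `u` to the class of `χ^u`. -/
def exponentClass : M →ₗ[ℤ] UnitClasses S (ResidueSemifield P) :=
  AddMonoidHom.toIntLinearMap
    { toFun := fun u => unitClass S (Additive.toMul (val hS P (0, u)))
      map_zero' := by
        rw [Prod.mk_zero_zero, map_zero]; rfl
      map_add' := fun u v => by
        rw [← unitClass_mul, show ((0, u + v) : valueSubgroup hS × M) = (0, u) + (0, v) by simp,
          map_add]
        rfl }

theorem exponentClass_apply (u : M) :
    exponentClass hS P u = unitClass S (Additive.toMul (val hS P (0, u))) := rfl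

theorem exponentClass_surjective : Function.Surjective (exponentClass hS P) := by
  intro a
  obtain ⟨b, rfl⟩ := unitClass_surjective a
  obtain ⟨g, hg⟩ := val_surjective hS P (Additive.ofMul b)
  refine ⟨g.2, ?_⟩
  rw [exponentClass_apply, unitClass_eq_iff hS]
  refine ⟨g.1, ?_⟩
  change Additive.ofMul b = val hS P (0, g.2) + val hS P (g.1, 0)
  rw [← hg, ← map_add, Prod.mk_add_mk, add_zero, zero_add]

theorem ker_exponentClass : LinearMap.ker (exponentClass hS P) = scalarExponents hS P := by
  ext u
  rw [LinearMap.mem_ker, exponentClass_apply, ← unitClass_one, eq_comm, unitClass_eq_iff hS,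
    mem_scalarExponents]
  have key : ∀ γ : valueSubgroup hS,
      Additive.toMul (val hS P (0, u)) = 1 * Additive.toMul (val hS P (γ, 0)) ↔
        val hS P (-γ, u) = 0 := by
    intro γ
    rw [one_mul, show ((-γ, u) : valueSubgroup hS × M) = (0, u) - (γ, 0) by simp, map_sub,
      sub_eq_zero]
    exact Iff.rfl
  simp only [key]
  exact ⟨fun ⟨γ, h⟩ => ⟨-γ, h⟩, fun ⟨γ, h⟩ => ⟨-γ, by rwa [neg_neg]⟩⟩

variable (P) in
/-- The quotient `κ(P)ˣ / Sˣ` as a quotient of the group of exponents. -/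
def quotientEquivUnitsQuotient :
    (M ⧸ scalarExponents hS P) ≃ₗ[ℤ] UnitClasses S (ResidueSemifield P) :=
  (Submodule.quotEquivOfEq _ _ (ker_exponentClass hS).symm).trans
    ((exponentClass hS P).quotKerEquivOfSurjective (exponentClass_surjective hS))

theorem unitsRank_eq [Module.Finite ℤ M] :
    unitsRank S (ResidueSemifield P) = Module.finrank ℤ (M ⧸ scalarExponents hS P) := by
  rw [unitsRank_def, ← (quotientEquivUnitsQuotient hS P).rank_eq, Module.finrank_eq_rank]

theorem tropVanishes_term {ι : Type*} (β : ι → (ResidueSemifield P)ˣ) {f : MvPolynomial ι S}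
    {m : ι →₀ ℕ} {γ : valueSubgroup hS} (h : f.coeff m = scalar γ) :
    termAt f (fun i => (β i : ResidueSemifield P)) m =
      ((Additive.toMul (val hS P (γ, 0)) * m.prod fun i k => β i ^ k :
        (ResidueSemifield P)ˣ) : ResidueSemifield P) := by
  rw [termAt, h, Units.val_mul, coe_val, mono_fst]
  congr 1
  have := map_finsuppProd (Units.coeHom (ResidueSemifield P)) m fun i k => β i ^ k
  refine Eq.trans ?_ this.symm
  exact Finsupp.prod_congr fun i _ => (Units.val_pow_eq_pow_val _ _).symm

include hS in
-- Terms of a polynomial are units whose class modulo $S^\times$ depends only on the exponent. Two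
-- exponents with the same class can be balanced by a scalar, and a repeated maximum gives two such
-- exponents.
theorem tropVanishes_imp_eq_zero_iff {ι : Type*} (β : ι → (ResidueSemifield P)ˣ) :
    (∀ f : MvPolynomial ι S, TropVanishes f (fun i => (β i : ResidueSemifield P)) → f = 0) ↔
      LinearIndependent ℕ fun i => unitClass S (β i) := by
  classical
  have h01 : (1 : ResidueSemifield P) ≠ 0 := by
    rw [← map_one (residueMap P), ← mono_zero hS]
    exact residueMap_mono_ne_zero hS P 0
  have hunit : ∀ a : (ResidueSemifield P)ˣ, (a : ResidueSemifield P) ≠ 0 := fun a ha => by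
    apply h01
    rw [← a.mul_inv, ha, zero_mul]
  constructor
  · intro h m m' hmm'
    by_contra hne
    rw [← unitClass_prod_pow, ← unitClass_prod_pow, eq_comm, unitClass_eq_iff hS] at hmm'
    obtain ⟨γ, hγ⟩ := hmm'
    -- The coefficient $\gamma$ is chosen so that both terms of the binomial have the same value.
    set f : MvPolynomial ι S := MvPolynomial.monomial m (scalar (0 : valueSubgroup hS)) +
      MvPolynomial.monomial m' (scalar γ) with hf
    have hcm : f.coeff m = scalar (0 : valueSubgroup hS) := by
      rw [hf, MvPolynomial.coeff_add, MvPolynomial.coeff_monomial, MvPolynomial.coeff_monomial,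
        if_pos rfl, if_neg (Ne.symm hne), add_zero]
    have hcm' : f.coeff m' = scalar γ := by
      rw [hf, MvPolynomial.coeff_add, MvPolynomial.coeff_monomial, MvPolynomial.coeff_monomial,
        if_pos rfl, if_neg hne, zero_add]
    have hsupp : f.support = {m, m'} := by
      ext n
      rw [MvPolynomial.mem_support_iff, Finset.mem_insert, Finset.mem_singleton]
      constructor
      · intro hn
        by_contra! hn'
        apply hn
        rw [hf, MvPolynomial.coeff_add, MvPolynomial.coeff_monomial, MvPolynomial.coeff_monomial,
          if_neg hn'.1.symm, if_neg hn'.2.symm, add_zero]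
      · rintro (rfl | rfl)
        · rw [hcm]; exact scalar_ne_zero _
        · rw [hcm']; exact scalar_ne_zero _
    have hterm : termAt f (fun i => (β i : ResidueSemifield P)) m =
        termAt f (fun i => (β i : ResidueSemifield P)) m' := by
      rw [tropVanishes_term hS β hcm, tropVanishes_term hS β hcm', hγ, Prod.mk_zero_zero, map_zero,
        mul_comm _ (Additive.toMul (val hS P (γ, 0)))]
      exact congrArg Units.val (one_mul _)
    have hidem := canonLE_refl (residue_total hS P)
      (termAt f (fun i => (β i : ResidueSemifield P)) m')
    refine scalar_ne_zero (0 : valueSubgroup hS) (?_ : scalar 0 = 0)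
    rw [← hcm, h f ?_, MvPolynomial.coeff_zero]
    intro n hn
    rw [hsupp, Finset.mem_insert, Finset.mem_singleton] at hn
    rw [hsupp, Finset.sum_pair hne, hterm, show _ + _ = _ from hidem]
    rcases hn with rfl | rfl
    · rw [show ({n, m'} : Finset (ι →₀ ℕ)) \ {n} = {m'} by
        ext k; simp only [Finset.mem_sdiff, Finset.mem_insert, Finset.mem_singleton]
        exact ⟨fun hk => hk.1.resolve_left hk.2, fun hk => ⟨Or.inr hk, hk ▸ Ne.symm hne⟩⟩,
        Finset.sum_singleton]
    · rw [show ({m, n} : Finset (ι →₀ ℕ)) \ {n} = {m} by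
        ext k; simp only [Finset.mem_sdiff, Finset.mem_insert, Finset.mem_singleton]
        exact ⟨fun hk => hk.1.resolve_right hk.2, fun hk => ⟨Or.inl hk, hk ▸ hne⟩⟩,
        Finset.sum_singleton, hterm]
  · intro h f hf
    by_contra hf0
    have hcoeff : ∀ m ∈ f.support, ∃ γ : valueSubgroup hS, f.coeff m = scalar γ := fun m hm =>
      exists_eq_scalar hS (MvPolynomial.mem_support_iff.1 hm)
    -- Deleting the largest term does not change the sum, so either that term is zero, which is
    -- impossible for a unit, or another term equals it.
    obtain ⟨m, hm, hsum, -⟩ := exists_sum_eq (residue_total hS P)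
      (s := f.support) (Finset.nonempty_iff_ne_empty.2 fun h => hf0 (MvPolynomial.support_eq_empty.1 h))
      (termAt f (fun i => (β i : ResidueSemifield P)))
    obtain ⟨γ, hγ⟩ := hcoeff m hm
    have hv := hf m hm
    rw [hsum, tropVanishes_term hS β hγ] at hv
    rcases (f.support \ {m}).eq_empty_or_nonempty with he | hne
    · rw [he, Finset.sum_empty] at hv
      exact hunit _ hv.symm
    · obtain ⟨m', hm', hsum', -⟩ := exists_sum_eq (residue_total hS P) hne
        (termAt f (fun i => (β i : ResidueSemifield P)))
      obtain ⟨hm's, hmm'⟩ := Finset.mem_sdiff.1 hm'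
      obtain ⟨γ', hγ'⟩ := hcoeff m' hm's
      rw [hsum', tropVanishes_term hS β hγ', Units.val_inj] at hv
      have hclass : ∀ (δ : valueSubgroup hS) (n : ι →₀ ℕ),
          unitClass S (Additive.toMul (val hS P (δ, 0)) * n.prod fun i k => β i ^ k) =
            Finsupp.linearCombination ℕ (fun i => unitClass S (β i)) n := fun δ n => by
        rw [unitClass_mul, unitClass_val_scalar, zero_add]
        exact unitClass_prod_pow β n
      have hcl := (hclass γ' m').symm.trans ((congrArg (unitClass S) hv).trans (hclass γ m))
      exact hmm' (Finset.mem_singleton.2 (h hcl))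

include hS in
theorem isUnit_residue {l : ResidueSemifield P} (hl : l ≠ 0) : IsUnit l := by
  obtain ⟨g, rfl⟩ := exists_residueMap_mono hS P hl
  exact (isUnit_mono hS g).map _

include hS in
-- If an element of the set were $0$, its own variable would be a nonzero polynomial vanishing
-- there.
theorem AlgIndep.ne_zero {B : Set (ResidueSemifield P)} (h : AlgIndep S B) (b : B) :
    (b : ResidueSemifield P) ≠ 0 := by
  intro hb
  have : Nontrivial S := ⟨⟨scalar (0 : valueSubgroup hS), 0, scalar_ne_zero _⟩⟩
  refine MvPolynomial.X_ne_zero (R := S) b (h _ ?_)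
  intro m hm
  have hX : ∀ m ∈ (MvPolynomial.X b : MvPolynomial B S).support,
      termAt (MvPolynomial.X b : MvPolynomial B S) (fun b => (b : ResidueSemifield P)) m = 0 := by
    intro m hm
    rw [MvPolynomial.support_X, Finset.mem_singleton] at hm
    rw [termAt, hm, Finsupp.prod_single_index (h := fun (b : B) k => (b : ResidueSemifield P) ^ k) (pow_zero _),
      hb, pow_one, mul_zero]
  rw [Finset.sum_eq_zero hX]
  exact Finset.sum_eq_zero fun m' hm' => hX m' ((@Finset.mem_sdiff _ (_) _ _ _).1 hm').1

include hS in
theorem trdeg_le_unitsRank : trdeg S (ResidueSemifield P) ≤ unitsRank S (ResidueSemifield P) := by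
  refine ciSup_le' fun B => ?_
  choose β hβ using fun b : B.1 => isUnit_residue hS (B.2.ne_zero hS b)
  have h1 : LinearIndependent ℕ fun b => unitClass S (β b) := by
    rw [← tropVanishes_imp_eq_zero_iff hS]
    intro f hf
    refine B.2 f ?_
    rwa [show (fun b : B.1 => (b : ResidueSemifield P)) = fun b => (β b : ResidueSemifield P) from
      funext fun b => (hβ b).symm]
  exact (linearIndependent_int_of_nat h1).cardinal_le_rank

theorem finrank_le_trdeg :
    (Module.finrank ℤ (M ⧸ scalarExponents hS P) : Cardinal) ≤ trdeg S (ResidueSemifield P) := by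
  obtain ⟨v, hv⟩ := exists_linearIndependent_of_le_finrank
    (le_refl (Module.finrank ℤ (M ⧸ scalarExponents hS P)))
  have hv' := hv.map' _ (quotientEquivUnitsQuotient hS P).ker
  choose β hβ using fun i => unitClass_surjective (((quotientEquivUnitsQuotient hS P) ∘ v) i)
  have hli : LinearIndependent ℤ fun i => unitClass S (β i) := by
    rw [show (fun i => unitClass S (β i)) = _ from funext hβ]
    exact hv'
  -- Independent classes are distinct, so the chosen units form a set of the full cardinality.
  have hinj : Function.Injective fun i => (β i : ResidueSemifield P) := fun i j hij =>
    hli.injective (congrArg (unitClass S) (Units.ext hij))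
  let B : Set (ResidueSemifield P) := Set.range fun i => (β i : ResidueSemifield P)
  let e : Fin (Module.finrank ℤ (M ⧸ scalarExponents hS P)) ≃ B := Equiv.ofInjective _ hinj
  have he : ∀ b : B, (β (e.symm b) : ResidueSemifield P) = b := fun b =>
    Equiv.apply_ofInjective_symm hinj b
  have hB : AlgIndep S B := by
    have h1 := (tropVanishes_imp_eq_zero_iff hS fun b => β (e.symm b)).2
      ((hli.comp _ e.symm.injective).restrict_scalars' ℕ)
    intro f hf
    refine h1 f ?_
    simpa only [he] using hf
  have hle := le_ciSup (f := fun B : {B : Set (ResidueSemifield P) // AlgIndep S B} =>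
    Cardinal.mk B.1) Cardinal.bddAbove_of_small ⟨B, hB⟩
  refine le_trans (le_of_eq ?_) hle
  have := Cardinal.mk_congr_lift e
  simpa using this

theorem trdeg_eq [Module.Finite ℤ M] :
    trdeg S (ResidueSemifield P) = Module.finrank ℤ (M ⧸ scalarExponents hS P) :=
  ((trdeg_le_unitsRank hS).trans_eq (unitsRank_eq hS)).antisymm (finrank_le_trdeg hS)

end Rank

end TropCont

end

theorem mainTheorem5 {M : Type*} [AddCommGroup M] [Module.Free ℤ M] [Module.Finite ℤ M]
    (S : Subsemiring TropCont.𝕋) (hS : TropCont.IsSubsemifield S)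
    (P : TropCont.PrimeCon (AddMonoidAlgebra S M))
    (hP : P ∈ TropCont.Cont S (AddMonoidAlgebra S M)) :
    ∃ d h : ℕ,
      IsLeast (TropCont.polyDim '' TropCont.primeFilter P) ((d : ℕ∞) : WithBot ℕ∞) ∧
      IsLeast (TropCont.polyDim '' {U ∈ TropCont.primeFilter P |
        TropCont.IsRationalPolyhedron (TropCont.valueGroup S) U}) ((d : ℕ∞) : WithBot ℕ∞) ∧
      TropCont.unitsRank S (TropCont.ResidueSemifield P) = d ∧
      P.ht = h ∧ (d : ℤ) = (Module.finrank ℤ M : ℤ) - h ∧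
      TropCont.trdeg S (TropCont.ResidueSemifield P) = d := by
  have hsharp := TropCont.sharp_of_mem_cont hS hP
  obtain ⟨Q, hQ, hpoly, hdim⟩ := TropCont.exists_polyhedron_mem_primeFilter hsharp
  have hle : ∀ U ∈ TropCont.primeFilter P, _ ≤ TropCont.polyDim U := fun U hU =>
    TropCont.le_polyDim_of_mem_primeFilter hsharp hU
  have hQdim := hdim.antisymm (hle Q hQ)
  -- Here $d=\operatorname{rk}(M/N)$ and $h=\operatorname{rk}N$, whose sum is $\operatorname{rk}M$.
  refine ⟨_, _, ⟨⟨Q, hQ, hQdim⟩, ?_⟩, ⟨⟨Q, ⟨hQ, hpoly⟩, hQdim⟩, ?_⟩, TropCont.unitsRank_eq hS,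
    TropCont.ht_eq_finrank hsharp, ?_, TropCont.trdeg_eq hS⟩
  · rintro _ ⟨U, hU, rfl⟩
    exact hle U hU
  · rintro _ ⟨U, hU, rfl⟩
    exact hle U hU.1
  · rw [eq_sub_iff_add_eq]
    exact_mod_cast Submodule.finrank_quotient_add_finrank (TropCont.scalarExponents hS P)
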